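/- Let $F$ be the free group on $x_1,x_2$, let $M=F/F''$ be the free metabelian group of rank 2, and let $\widehat M$ be its profinite completion (the free profinite metabelian group of rank 2). Let $\widehat A=\widehat M/\overline{[\widehat M,\widehat M]}$ be its abelianization, identified with $\widehat{\mathbb Z}^2$ by sending the class of $x_j$ to the $j$-th basis vector, and let $\mathrm{SL}(\widehat A)\subset\mathrm{Aut}(\widehat A)$ be the group of automorphisms given by matrices in $\mathrm{SL}_2(\widehat{\mathbb Z})$. For a profinite group $G$ let $\mathrm{Aut}(G)$ be the group of continuous automorphisms with the compact-open topology, and let $\mathrm{Out}(G)=\mathrm{Aut}(G)/\mathrm{Inn}(G)$ have the quotient topology; abelianization induces $\mathrm{ab}_*:\mathrm{Out}(\widehat M)\to\mathrm{Aut}(\widehat A)$. There is a unique continuous homomorphism $$\rho:\widehat{\mathrm{SL}_2(\mathbb Z)}\longrightarrow\mathrm{Out}(\widehat M)$$ from the profinite completion of $\mathrm{SL}_2(\mathbb Z)$ such that, for every $\gamma\in\mathrm{SL}_2(\mathbb Z)$ and every automorphism $\varphi$ of $F$ that acts on $F/F'=\mathbb Z^2$ by $\gamma$, $\rho(\gamma)$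 is the class of the automorphism of $\widehat M$ induced by $\varphi$. Its image is precisely $\mathrm{SL}(\widehat A)\cong\mathrm{SL}_2(\widehat{\mathbb Z})$, in the following sense: 1. $\mathrm{ab}_*$ maps the image of $\rho$ bijectively onto $\mathrm{SL}(\widehat A)$. 2. There is an isomorphism of topological groups $e:\mathrm{SL}_2(\widehat{\mathbb Z})\to\mathrm{im}(\rho)$ such that $\mathrm{ab}_*(e(g))$ is the automorphism of $\widehat A$ with matrix $g$, and such that $\rho$ is the composite of the canonical map $\widehat{\mathrm{SL}_2(\mathbb Z)}\to\mathrm{SL}_2(\widehat{\mathbb Z})$ with $e$. In particular $\rho$ factors through $\mathrm{SL}_2(\widehat{\mathbb Z})$ (the class of metabelian groups is geometrically congruence). 3. The kernel of $\rho$ is the congruence kernel $\bigcap_{n\ge1}\overline{\Gamma(n)}$, where $\Gamma(n)=\ker(\mathrm{SL}_2(\mathbb Z)\to\mathrm{SL}_2(\mathbb Z/n))$ and the closures are taken in $\widehat{\mathrm{SL}_2(\mathbb Z)}$; that is, exactly the elements of the congruence kernel act on $\widehat M$ by inner automorphisms. -/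

import Mathlib

open CategoryTheory ProfiniteGrp
open scoped MatrixGroups

namespace ProMetabelian

/-! ### The profinite integers -/

/-- The ring of profinite integers, as the inverse limit of the rings `ℤ / n` over `n ≥ 1`, with the
topology induced from the product of the discrete rings `ℤ / n`. -/
def ZHat : Subring (∀ n : ℕ+, ZMod n) where
  carrier := {x | ∀ (m n : ℕ+) (h : (m : ℕ) ∣ n), ZMod.castHom h (ZMod m) (x n) = x m}
  mul_mem' {a b} ha hb m n h := by simp only [Pi.mul_apply, map_mul, ha m n h, hb m n h]
  one_mem' m n h := by simp only [Pi.one_apply, map_one]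
  add_mem' {a b} ha hb m n h := by simp only [Pi.add_apply, map_add, ha m n h, hb m n h]
  zero_mem' m n h := by simp only [Pi.zero_apply, map_zero]
  neg_mem' {a} ha m n h := by simp only [Pi.neg_apply, map_neg, ha m n h]

theorem isClosed_ZHat : IsClosed (ZHat : Set (∀ n : ℕ+, ZMod n)) := by
  have : (ZHat : Set (∀ n : ℕ+, ZMod n)) = ⋂ (m : ℕ+) (n : ℕ+) (h : (m : ℕ) ∣ n),
      {x : ∀ n : ℕ+, ZMod n | ZMod.castHom h (ZMod m) (x n) = x m} := by
    ext x
    simp only [Set.mem_iInter]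
    rfl
  rw [this]
  refine isClosed_iInter fun m => isClosed_iInter fun n => isClosed_iInter fun h => ?_
  exact isClosed_eq (continuous_of_discreteTopology.comp (continuous_apply n)) (continuous_apply m)

instance : CompactSpace ZHat := isCompact_iff_compactSpace.mp isClosed_ZHat.isCompact

instance : TotallyDisconnectedSpace ZHat := inferInstance

/-! ### Continuous automorphisms and outer automorphisms of topological groups -/

section Out

variable (G : Type) [Group G] [TopologicalSpace G]

/-- The group `Aut(G)` of automorphisms of a topological group `G`, i.e. the bicontinuous group
automorphisms; multiplication is composition. -/
def contAut : Subgroup (MulAut G) where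
  carrier := {f | Continuous f ∧ Continuous f.symm}
  mul_mem' {_ _} hf hg := ⟨hf.1.comp hg.1, hg.2.comp hf.2⟩
  one_mem' := ⟨continuous_id, continuous_id⟩
  inv_mem' {_} hf := ⟨hf.2, hf.1⟩

/-- The compact-open topology on `Aut(G)`. (For compact `G` inversion is
continuous in this topology.) -/
instance : TopologicalSpace (contAut G) :=
  TopologicalSpace.induced (fun f => (⟨f.1, f.2.1⟩ : C(G, G))) inferInstance

/-- The subgroup `Inn(G)` of inner automorphisms of `G` in `Aut(G)`. -/
def innAut : Subgroup (contAut G) := (MulAut.conj : G →* MulAut G).range.subgroupOf (contAut G)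

instance : (innAut G).Normal := by
  constructor
  rintro n ⟨x, hx⟩ g
  refine ⟨g.1 x, ?_⟩
  ext y
  have h := congrArg (fun f : MulAut G => g.1 (f (g.1⁻¹ y))) hx
  simpa using h

/-- The group `Out(G) = Aut(G) / Inn(G)`, with the quotient topology. -/
abbrev ContOut : Type := contAut G ⧸ innAut G

end Out

section Abelianization

variable (G : Type) [Group G] [TopologicalSpace G] [IsTopologicalGroup G]

theorem map_closure_commutator (f : contAut G) :
    (commutator G).topologicalClosure.map (f.1 : G ≃* G).toMonoidHom =
      (commutator G).topologicalClosure := by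
  have key : ∀ f : contAut G, (commutator G).topologicalClosure.map (f.1 : G ≃* G).toMonoidHom ≤
      (commutator G).topologicalClosure := by
    intro f
    rw [Subgroup.map_le_iff_le_comap]
    refine Subgroup.topologicalClosure_minimal _ ?_
      ((Subgroup.isClosed_topologicalClosure _).preimage f.2.1)
    rw [← Subgroup.map_le_iff_le_comap]
    refine le_trans ?_ (Subgroup.le_topologicalClosure _)
    rw [commutator_def, Subgroup.map_commutator]
    exact Subgroup.commutator_mono le_top le_top
  refine le_antisymm (key f) fun x hx => ?_
  refine ⟨f.1.symm x, key f⁻¹ ⟨x, hx, rfl⟩, f.1.apply_symm_apply x⟩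

/-- The action of a continuous automorphism of `G` on the topological abelianization of `G`. -/
def abAut : contAut G →* contAut (TopologicalAbelianization G) where
  toFun f := ⟨QuotientGroup.congr _ _ f.1 (map_closure_commutator G f),
    (QuotientGroup.continuous_mk.comp f.2.1).quotient_lift _,
    (QuotientGroup.continuous_mk.comp f.2.2).quotient_lift _⟩
  map_one' := by
    ext x
    induction x using QuotientGroup.induction_on
    rfl
  map_mul' f g := by
    ext x
    induction x using QuotientGroup.induction_on
    rfl

/-- The homomorphism `ab_* : Out(G) → Aut(G^ab)` induced by abelianization. -/
def abOut : ContOut G →* contAut (TopologicalAbelianization G) :=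
  QuotientGroup.lift (innAut G) (abAut G) <| by
    rintro f ⟨x, hx⟩
    ext y
    induction y using QuotientGroup.induction_on with
    | H y =>
      have h : f.1 y = x * y * x⁻¹ := (congrArg (fun e : MulAut G => e y) hx).symm
      have h1 : ((abAut G f).1 : _ → _) (QuotientGroup.mk y) =
          (QuotientGroup.mk (f.1 y) : TopologicalAbelianization G) := rfl
      rw [h1, h, QuotientGroup.mk_mul, QuotientGroup.mk_mul, QuotientGroup.mk_inv,
        mul_comm (QuotientGroup.mk x : TopologicalAbelianization G), mul_inv_cancel_right]
      rfl

end Abelianization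

/-! ### The free profinite metabelian group of rank 2 -/

/-- The free group of rank 2. -/
abbrev F : Type := FreeGroup (Fin 2)

/-- The free metabelian group `F / F''` of rank 2. -/
abbrev M : Type := F ⧸ derivedSeries F 2

/-- The free profinite metabelian group of rank 2: the profinite completion of `F / F''`. -/
abbrev MHat : ProfiniteGrp.{0} := ProfiniteCompletion.completion (GrpCat.of M)

/-- The canonical map from the free group to the free profinite metabelian group. -/
noncomputable def toMHat : F →* MHat :=
  (ProfiniteCompletion.eta (GrpCat.of M)).hom.comp (QuotientGroup.mk' (derivedSeries F 2))

/-- The automorphism of `F / F''` induced by an automorphism of `F`. -/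
def autM : MulAut F →* MulAut M where
  toFun φ := QuotientGroup.congr _ _ φ
    (Subgroup.characteristic_iff_map_eq.mp (derivedSeries_characteristic F 2) φ)
  map_one' := by
    ext x
    induction x using QuotientGroup.induction_on
    rfl
  map_mul' f g := by
    ext x
    induction x using QuotientGroup.induction_on
    rfl

/-- The continuous endomorphism of the profinite completion induced by an endomorphism of
`F / F''`. -/
noncomputable def mapMHat (f : M →* M) : MHat →ₜ* MHat :=
  (profiniteCompletion.map (GrpCat.ofHom f : GrpCat.of M ⟶ GrpCat.of M)).hom

theorem mapMHat_comp (f g : M →* M) (x : MHat) :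
    mapMHat (f.comp g) x = mapMHat f (mapMHat g x) := by
  unfold mapMHat
  rw [GrpCat.ofHom_comp, Functor.map_comp]
  rfl

theorem mapMHat_id (x : MHat) : mapMHat (MonoidHom.id M) x = x := by
  unfold mapMHat
  rw [GrpCat.ofHom_id, CategoryTheory.Functor.map_id]
  rfl

theorem mapMHat_eta (f : M →* M) (m : M) :
    mapMHat f (ProfiniteCompletion.etaFn (GrpCat.of M) m) =
      ProfiniteCompletion.etaFn (GrpCat.of M) (f m) :=
  ConcreteCategory.congr_hom (ProfiniteCompletion.lift_eta
    ((GrpCat.ofHom f : GrpCat.of M ⟶ GrpCat.of M) ≫ ProfiniteCompletion.eta (GrpCat.of M))) m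

/-- The natural homomorphism from `Aut(F)` to the group of continuous automorphisms of the free
profinite metabelian group. -/
noncomputable def autMHat : MulAut F →* contAut MHat where
  toFun φ := ⟨{
      toFun := mapMHat (autM φ).toMonoidHom
      invFun := mapMHat (autM φ⁻¹).toMonoidHom
      left_inv := fun x => by
        rw [← mapMHat_comp]
        convert! mapMHat_id x
        refine MonoidHom.ext fun y => ?_
        change (autM φ⁻¹ * autM φ) y = y
        rw [← map_mul, inv_mul_cancel, map_one]
        rfl
      right_inv := fun x => by
        rw [← mapMHat_comp]
        convert! mapMHat_id x
        refine MonoidHom.ext fun y => ?_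
        change (autM φ * autM φ⁻¹) y = y
        rw [← map_mul, mul_inv_cancel, map_one]
        rfl
      map_mul' := map_mul _ },
    (mapMHat (autM φ).toMonoidHom).continuous_toFun,
    (mapMHat (autM φ⁻¹).toMonoidHom).continuous_toFun⟩
  map_one' := by
    apply Subtype.ext
    ext x : 1
    change mapMHat (autM 1).toMonoidHom x = x
    rw [map_one]
    exact mapMHat_id x
  map_mul' φ ψ := by
    apply Subtype.ext
    ext x : 1
    change mapMHat (autM (φ * ψ)).toMonoidHom x =
      mapMHat (autM φ).toMonoidHom (mapMHat (autM ψ).toMonoidHom x)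
    rw [map_mul, ← mapMHat_comp]
    rfl

/-- `autMHat φ` extends `φ`. -/
theorem autMHat_toMHat (φ : MulAut F) (w : F) : (autMHat φ).1 (toMHat w) = toMHat (φ w) :=
  mapMHat_eta (autM φ).toMonoidHom (QuotientGroup.mk w)

/-! ### Abelianizations: `F → ℤ²` and `MHat → ZHat²` -/

/-- The abelianization `F → ℤ²`, sending the `j`-th generator to the `j`-th basis vector. -/
def abF : F →* Multiplicative (Fin 2 → ℤ) :=
  FreeGroup.lift fun j => Multiplicative.ofAdd (Pi.single j 1)

/-- The matrix of the automorphism of `ℤ²` induced by an automorphism of `F`: its `j`-th column is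
the image in `ℤ²` of `φ (x_j)`. -/
def abMatrix (φ : MulAut F) : Matrix (Fin 2) (Fin 2) ℤ :=
  Matrix.of fun i j => (abF (φ (FreeGroup.of j))).toAdd i

/-- The homomorphism `F → ZHat²` sending the `j`-th generator to the `j`-th basis vector. -/
def abFHat : F →* Multiplicative (Fin 2 → ZHat) :=
  FreeGroup.lift fun j => Multiplicative.ofAdd (Pi.single j 1)

theorem derivedSeries_two_le_ker {B : Type*} [CommGroup B] (f : F →* B) :
    derivedSeries F 2 ≤ f.ker := by
  refine le_trans (derivedSeries_antitone F one_le_two) ?_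
  rw [derivedSeries_one]
  exact Abelianization.commutator_subset_ker f

/-- The continuous homomorphism `MHat → ZHat²` sending the `j`-th generator to the `j`-th basis
vector. -/
noncomputable def coordMHat : MHat →ₜ* Multiplicative (Fin 2 → ZHat) :=
  (ProfiniteCompletion.lift (P := ProfiniteGrp.of (Multiplicative (Fin 2 → ZHat)))
    (GrpCat.ofHom (QuotientGroup.lift (derivedSeries F 2) abFHat
      (derivedSeries_two_le_ker abFHat)) :
      GrpCat.of M ⟶ GrpCat.of (Multiplicative (Fin 2 → ZHat)))).hom

theorem coordMHat_toMHat (w : F) : coordMHat (toMHat w) = abFHat w :=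
  ConcreteCategory.congr_hom (ProfiniteCompletion.lift_eta
    (P := ProfiniteGrp.of (Multiplicative (Fin 2 → ZHat)))
    (GrpCat.ofHom (QuotientGroup.lift (derivedSeries F 2) abFHat
      (derivedSeries_two_le_ker abFHat)) :
      GrpCat.of M ⟶ GrpCat.of (Multiplicative (Fin 2 → ZHat)))) (QuotientGroup.mk w)

theorem abFHat_apply (w : F) (i : Fin 2) :
    (abFHat w).toAdd i = (((abF w).toAdd i : ℤ) : ZHat) := by
  let q : Multiplicative (Fin 2 → ℤ) →* Multiplicative (Fin 2 → ZHat) :=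
    AddMonoidHom.toMultiplicative
      { toFun := fun v i => ((v i : ℤ) : ZHat)
        map_zero' := by ext i; simp
        map_add' := fun v w => by ext i; simp }
  have h : abFHat = q.comp abF := by
    ext j : 1
    simp only [abFHat, abF, MonoidHom.comp_apply, FreeGroup.lift_apply_of]
    apply Multiplicative.toAdd.injective
    funext i
    change (Pi.single j (1 : ZHat) : Fin 2 → ZHat) i =
      (((Pi.single j (1 : ℤ) : Fin 2 → ℤ) i : ℤ) : ZHat)
    by_cases hij : i = j
    · subst hij; simp
    · simp [hij]
  rw [h]
  rfl

theorem abF_surjective : Function.Surjective abF := by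
  intro v
  refine ⟨FreeGroup.of 0 ^ (v.toAdd 0) * FreeGroup.of 1 ^ (v.toAdd 1), ?_⟩
  apply Multiplicative.toAdd.injective
  funext i
  rw [map_mul, map_zpow, map_zpow, toAdd_mul, toAdd_zpow, toAdd_zpow]
  simp only [abF, FreeGroup.lift_apply_of]
  fin_cases i <;> simp

theorem denseRange_toMHat : DenseRange toMHat := by
  have h := ProfiniteCompletion.denseRange (GrpCat.of M)
  have h2 : Set.range toMHat = Set.range (ProfiniteCompletion.etaFn (GrpCat.of M)) :=
    (QuotientGroup.mk'_surjective (derivedSeries F 2)).range_comp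
      (ProfiniteCompletion.etaFn (GrpCat.of M))
  unfold DenseRange
  rw [h2]
  exact h

theorem coordMHat_surjective : Function.Surjective coordMHat := by
  have hcl : IsClosed (Set.range coordMHat) :=
    (isCompact_range coordMHat.continuous_toFun).isClosed
  intro v
  let N : ℕ → ℕ+ := fun m => ⟨m.factorial, m.factorial_pos⟩
  have hz : ∀ (x : ZHat) (m : ℕ), ∃ k : ℤ, (k : ZMod (N m)) = x.1 (N m) := fun x m =>
    ZMod.intCast_surjective _
  choose k hk using hz
  have hw : ∀ m : ℕ, ∃ w : F, abF w = Multiplicative.ofAdd fun i => k (v.toAdd i) m := fun m =>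
    abF_surjective _
  choose w hw using hw
  change v ∈ Set.range coordMHat
  refine hcl.mem_of_tendsto (f := fun m => coordMHat (toMHat (w m))) (b := Filter.atTop) ?_
    (Filter.Eventually.of_forall fun m => ⟨toMHat (w m), rfl⟩)
  have hlim : Filter.Tendsto (fun m => (coordMHat (toMHat (w m))).toAdd) Filter.atTop
      (nhds v.toAdd) := by
    rw [tendsto_pi_nhds]
    intro i
    rw [tendsto_subtype_rng, tendsto_pi_nhds]
    intro n
    apply tendsto_nhds_of_eventually_eq
    filter_upwards [Filter.eventually_ge_atTop (n : ℕ)] with m hm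
    have hd : (n : ℕ) ∣ N m := Nat.dvd_factorial n.pos hm
    rw [coordMHat_toMHat, abFHat_apply, hw]
    have h1 := congrArg (ZMod.castHom hd (ZMod n)) (hk (v.toAdd i) m)
    rw [(v.toAdd i).2 n (N m) hd, map_intCast] at h1
    exact h1
  exact (continuous_ofAdd.tendsto v.toAdd).comp hlim

theorem ker_coordMHat :
    coordMHat.toMonoidHom.ker = (commutator MHat).topologicalClosure := by
  apply le_antisymm
  · intro a ha
    change a ∈ closure (commutator MHat : Set MHat)
    rw [mem_closure_iff]
    intro O hO haO
    obtain ⟨U, hU⟩ := exist_openNormalSubgroup_sub_open_nhds_of_one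
      (hO.preimage (continuous_const_mul a)) (show a * 1 ∈ O by rwa [mul_one])
    have : Finite (MHat ⧸ U.toSubgroup) := Subgroup.quotient_finite_of_isOpen _ U.isOpen'
    have hidx : U.toSubgroup.index ≠ 0 := Subgroup.index_ne_zero_of_finite
    let n : ℕ+ := ⟨U.toSubgroup.index, Nat.pos_of_ne_zero hidx⟩
    let V : Set MHat := {g | a⁻¹ * g ∈ U.toSubgroup} ∩
      {g | ∀ i, ((coordMHat g).toAdd i).1 n = 0}
    have hV : IsOpen V := by
      refine (U.isOpen'.preimage (continuous_const_mul a⁻¹)).inter ?_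
      rw [Set.ofPred_forall]
      refine isOpen_iInter_of_finite fun i => ?_
      refine (isOpen_discrete ({0} : Set (ZMod n))).preimage
        (f := fun g => ((coordMHat g).toAdd i).1 n) ?_
      exact (continuous_apply n).comp (continuous_subtype_val.comp ((continuous_apply i).comp
        (continuous_toAdd.comp coordMHat.continuous_toFun)))
    have haV : a ∈ V := by
      refine ⟨?_, fun i => ?_⟩
      · change a⁻¹ * a ∈ U.toSubgroup
        rw [inv_mul_cancel]
        exact one_mem _
      · have h : coordMHat a = 1 := ha
        rw [h]
        rfl
    obtain ⟨w, hwU, hwn⟩ := denseRange_toMHat.exists_mem_open hV ⟨a, haV⟩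
    let r : Multiplicative (Fin 2 → ℤ) →* Abelianization F :=
      { toFun := fun v => Abelianization.of (FreeGroup.of 0) ^ (v.toAdd 0) *
          Abelianization.of (FreeGroup.of 1) ^ (v.toAdd 1)
        map_one' := by simp
        map_mul' := fun v w => by
          simp only [toAdd_mul, Pi.add_apply, zpow_add]
          exact mul_mul_mul_comm _ _ _ _ }
    have hr : (Abelianization.of : F →* Abelianization F) = r.comp abF := by
      ext j : 1
      fin_cases j <;> simp [r, abF]
    have hdvd : ∀ i, ∃ e : ℤ, (abF w).toAdd i = (n : ℕ) * e := by
      intro i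
      have h := hwn i
      rw [coordMHat_toMHat, abFHat_apply] at h
      exact (ZMod.intCast_zmod_eq_zero_iff_dvd _ _).mp h
    choose e he using hdvd
    let p : F := FreeGroup.of 0 ^ ((abF w).toAdd 0) * FreeGroup.of 1 ^ ((abF w).toAdd 1)
    have hp : toMHat p ∈ U.toSubgroup := by
      have hpow : ∀ (g : MHat) (k : ℤ), g ^ (((n : ℕ) : ℤ) * k) ∈ U.toSubgroup := by
        intro g k
        rw [zpow_mul, zpow_natCast]
        exact zpow_mem (U.toSubgroup.pow_index_mem g) k
      simp only [p, map_mul, map_zpow, he]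
      exact mul_mem (hpow _ _) (hpow _ _)
    have hcomm : p⁻¹ * w ∈ commutator F := by
      rw [← Abelianization.ker_of, MonoidHom.mem_ker, map_mul, map_inv, inv_mul_eq_one]
      rw [DFunLike.congr_fun hr w]
      simp [p, r]
    refine ⟨toMHat (p⁻¹ * w), ?_, ?_⟩
    · suffices hs : a⁻¹ * toMHat (p⁻¹ * w) ∈ U.toSubgroup by
        have h5 : a * (a⁻¹ * toMHat (p⁻¹ * w)) ∈ O := hU hs
        rwa [mul_inv_cancel_left] at h5
      have hw' : a⁻¹ * toMHat w ∈ U.toSubgroup := hwU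
      have h2 : a⁻¹ * toMHat (p⁻¹ * w) =
          (a⁻¹ * (toMHat p)⁻¹ * a) * (a⁻¹ * toMHat w) := by
        rw [map_mul, map_inv]
        group
      rw [h2]
      refine mul_mem ?_ hw'
      have h3 := U.isNormal'.conj_mem _ (inv_mem hp) a⁻¹
      rwa [inv_inv] at h3
    · have h4 : (commutator F).map toMHat ≤ commutator MHat := by
        rw [commutator_def, Subgroup.map_commutator]
        exact Subgroup.commutator_mono le_top le_top
      exact h4 ⟨_, hcomm, rfl⟩
  · refine Subgroup.topologicalClosure_minimal _ (Abelianization.commutator_subset_ker _) ?_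
    exact isClosed_singleton.preimage coordMHat.continuous_toFun

/-- The abelianization `MHat^ab` of the free profinite metabelian group of rank 2. -/
abbrev AHat : Type := TopologicalAbelianization MHat

/-- The isomorphism `MHat^ab ≅ ZHat²` sending the class of the `j`-th generator to the `j`-th basis
vector. -/
noncomputable def coordAHat : AHat ≃* Multiplicative (Fin 2 → ZHat) :=
  (QuotientGroup.quotientMulEquivOfEq ker_coordMHat.symm).trans
    (QuotientGroup.quotientKerEquivOfSurjective coordMHat.toMonoidHom coordMHat_surjective)

theorem coordAHat_mk (g : MHat) : coordAHat (QuotientGroup.mk g) = coordMHat g := rfl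

theorem continuous_coordAHat : Continuous coordAHat := by
  rw [(QuotientGroup.isQuotientMap_mk (N := (commutator MHat).topologicalClosure)).continuous_iff]
  exact coordMHat.continuous_toFun

theorem continuous_coordAHat_symm : Continuous coordAHat.symm :=
  (Continuous.homeoOfEquivCompactToT2 (f := coordAHat.toEquiv) continuous_coordAHat).symm.continuous

/-! ### Special linear groups -/

/-- The automorphism of `MHat^ab ≅ ZHat²` given by a matrix of determinant one. -/
noncomputable def slAct : SL(2, ZHat) →* contAut AHat where
  toFun g := ⟨(coordAHat.trans (AddEquiv.toMultiplicative
      (Matrix.SpecialLinearGroup.toLin' g).toAddEquiv)).trans coordAHat.symm,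
    continuous_coordAHat_symm.comp (continuous_ofAdd.comp
      ((Continuous.matrix_mulVec continuous_const
        (continuous_toAdd.comp continuous_coordAHat)) : _)),
    continuous_coordAHat_symm.comp (continuous_ofAdd.comp
      ((Continuous.matrix_mulVec continuous_const
        (continuous_toAdd.comp continuous_coordAHat)) : _))⟩
  map_one' := by
    apply Subtype.ext
    ext x
    simp
  map_mul' g h := by
    apply Subtype.ext
    ext x
    simp

/-- `SL(MHat^ab)`: the automorphisms of `MHat^ab ≅ ZHat²` that are given by matrices of determinant
one. -/
noncomputable def SLAHat : Subgroup (contAut AHat) := slAct.range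

instance : CompactSpace SL(2, ZHat) :=
  have : CompactSpace (Matrix (Fin 2) (Fin 2) ZHat) :=
    inferInstanceAs (CompactSpace (Fin 2 → Fin 2 → ZHat))
  Matrix.SpecialLinearGroup.isClosedEmbedding_val.compactSpace

instance : TotallyDisconnectedSpace SL(2, ZHat) :=
  have : TotallyDisconnectedSpace (Matrix (Fin 2) (Fin 2) ZHat) :=
    inferInstanceAs (TotallyDisconnectedSpace (Fin 2 → Fin 2 → ZHat))
  inferInstanceAs (TotallyDisconnectedSpace (Subtype _))

/-- The profinite completion of `SL₂(ℤ)`. -/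
abbrev SL2ZCompletion : ProfiniteGrp.{0} := ProfiniteCompletion.completion (GrpCat.of SL(2, ℤ))

/-- The canonical map from `SL₂(ℤ)` to its profinite completion. -/
def toSL2ZCompletion : SL(2, ℤ) →* SL2ZCompletion :=
  (ProfiniteCompletion.eta (GrpCat.of SL(2, ℤ))).hom

/-- The canonical continuous homomorphism from the profinite completion of `SL₂(ℤ)` to
`SL₂(ZHat)`. -/
noncomputable def toSL2ZHat : SL2ZCompletion →ₜ* SL(2, ZHat) :=
  (ProfiniteCompletion.lift (P := ProfiniteGrp.of SL(2, ZHat))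
    (GrpCat.ofHom (Matrix.SpecialLinearGroup.map (Int.castRingHom ZHat)) :
      GrpCat.of SL(2, ℤ) ⟶ GrpCat.of SL(2, ZHat))).hom

theorem toSL2ZHat_toSL2ZCompletion (g : SL(2, ℤ)) :
    toSL2ZHat (toSL2ZCompletion g) = Matrix.SpecialLinearGroup.map (Int.castRingHom ZHat) g :=
  ConcreteCategory.congr_hom (ProfiniteCompletion.lift_eta
    (P := ProfiniteGrp.of SL(2, ZHat))
    (GrpCat.ofHom (Matrix.SpecialLinearGroup.map (Int.castRingHom ZHat)) :
      GrpCat.of SL(2, ℤ) ⟶ GrpCat.of SL(2, ZHat))) g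

/-- `ρ` is the outer representation of the profinite completion of `SL₂(ℤ)` on `MHat`: it is the
continuous extension of the homomorphism `SL₂(ℤ) ⊆ GL₂(ℤ) = Out(F) → Out(MHat)`, where an outer
automorphism of `F` is identified with the matrix by which it acts on `ℤ²`. -/
def IsOuterRepresentation (ρ : SL2ZCompletion →* ContOut MHat) : Prop :=
  Continuous ρ ∧ ∀ (φ : MulAut F) (γ : SL(2, ℤ)), abMatrix φ = γ.val →
    ρ (toSL2ZCompletion γ) = QuotientGroup.mk (autMHat φ)

/-- The congruence kernel: the intersection over `n ≥ 1` of the closures of the principal congruence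
subgroups `Γ(n)` in the profinite completion of `SL₂(ℤ)`. -/
def congruenceKernel : Set SL2ZCompletion :=
  ⋂ n ≥ 1, closure (toSL2ZCompletion '' (CongruenceSubgroup.Gamma n : Set SL(2, ℤ)))

end ProMetabelian

open ProMetabelian

/-! Write c = [x₁, x₂], and let Γ (`gammaHat`) be the group of automorphisms of `MHat` that have
determinant one on `ZHat²` and send c to a conjugate. The heart of the matter is that Γ/Inn →
SL₂(ZHat) is an isomorphism of topological groups (`gammaOutToSL_bijective`). Then ρ is `toSL2ZHat`
followed by the inverse isomorphism, and its kernel is the kernel of `toSL2ZHat`, which is the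
congruence kernel.

Surjectivity: Γ is compact, and its image contains the dense subgroup SL₂(ℤ), because the standard
generators S and T lift to automorphisms of F that send c to a conjugate (`exists_lift_SL2Z`,
`denseRange_SL2Z`).

Injectivity (`mem_innAut_of_fixes_commutator`): after an inner correction, θ fixes c and θ(xᵢ) =
nᵢxᵢ with nᵢ in the closed derived subgroup. This subgroup is abelian, and ℤ[a, b] acts on it by
conjugation. In additive notation θ(c) = c reads (a - 1)n₂ = (b - 1)n₁. Since the closed derived
subgroup is free on c over the completed group ring of `ZHat²`, Koszul exactness for (a - 1, b - 1)
should give n₁ = (a - 1)u and n₂ = (b - 1)u, so that θ is conjugation by -u. The completed ring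
itself is avoided: one works modulo (n, a^k - 1, b^k - 1), where exactness holds at the price of
lowering k (`exists_koszul_lift`). Affine representations control the annihilator of c
(`exists_mul_mem_levelIdeal`), and compactness passes to the limit.

Finally, ρ is prescribed on every lift of γ to F, and two lifts differ by an automorphism trivial on
ℤ². On F/F'' such an automorphism multiplies c by a unit of the Laurent polynomial ring, hence by ±
a monomial. Augmentation makes the sign +, so c goes to a conjugate
(`exists_conj_commutatorElement`) and every lift lies in Γ. -/

namespace ProMetabelian

/-! ### Bivariate integral polynomials -/

section Bivariate

open Polynomial

/-- The ring `ℤ[b][a]`; the variables are `a = X` and `b = C X`. -/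
abbrev BiPoly : Type := ℤ[X][X]

/-- The ideal of `ℤ[b][a]` generated by `n`, `a ^ k - 1` and `b ^ k - 1`. -/
noncomputable def levelIdeal (n k : ℕ) : Ideal BiPoly :=
  Ideal.span {(n : BiPoly), X ^ k - 1, C X ^ k - 1}

theorem natCast_mem_levelIdeal (n k : ℕ) : (n : BiPoly) ∈ levelIdeal n k :=
  Ideal.subset_span (by simp)

theorem X_pow_sub_one_mem_levelIdeal (n k : ℕ) : (X ^ k - 1 : BiPoly) ∈ levelIdeal n k :=
  Ideal.subset_span (by simp)

theorem C_X_pow_sub_one_mem_levelIdeal (n k : ℕ) : (C X ^ k - 1 : BiPoly) ∈ levelIdeal n k :=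
  Ideal.subset_span (by simp)

theorem mem_levelIdeal {n k : ℕ} {f : BiPoly} :
    f ∈ levelIdeal n k ↔ ∃ p q r : BiPoly,
      f = (n : BiPoly) * p + (X ^ k - 1) * q + (C X ^ k - 1) * r := by
  constructor
  · intro h
    obtain ⟨p, z, hz, rfl⟩ := Ideal.mem_span_insert.mp h
    obtain ⟨q, w, hw, rfl⟩ := Ideal.mem_span_insert.mp hz
    obtain ⟨r, rfl⟩ := Ideal.mem_span_singleton'.mp hw
    exact ⟨p, q, r, by ring⟩
  · rintro ⟨p, q, r, rfl⟩
    exact add_mem (add_mem (Ideal.mul_mem_right _ _ (natCast_mem_levelIdeal n k))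
      (Ideal.mul_mem_right _ _ (X_pow_sub_one_mem_levelIdeal n k)))
      (Ideal.mul_mem_right _ _ (C_X_pow_sub_one_mem_levelIdeal n k))

theorem levelIdeal_le_of_dvd {n k l : ℕ} (h : k ∣ l) : levelIdeal n l ≤ levelIdeal n k := by
  obtain ⟨m, rfl⟩ := h
  intro f hf
  obtain ⟨p, q, r, rfl⟩ := mem_levelIdeal.mp hf
  have key : ∀ t : BiPoly, t ^ k - 1 ∈ levelIdeal n k → t ^ (k * m) - 1 ∈ levelIdeal n k := by
    intro t ht
    refine Ideal.mem_of_dvd _ ?_ ht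
    rw [pow_mul]
    simpa using sub_dvd_pow_sub_pow (t ^ k) 1 m
  exact add_mem (add_mem (Ideal.mul_mem_right _ _ (natCast_mem_levelIdeal n k))
      (Ideal.mul_mem_right _ _ (key _ (X_pow_sub_one_mem_levelIdeal n k))))
      (Ideal.mul_mem_right _ _ (key _ (C_X_pow_sub_one_mem_levelIdeal n k)))

/-- The sum of length nk factors as a sum of length k times ∑_{j<n} t^{kj}, and the second factor is
n modulo I. This is why the level is allowed to drop by a factor n each time a - 1 or b - 1 is
cancelled. -/
theorem geom_sum_mem_of_pow_sub_one_mem {R : Type*} [CommRing R] (I : Ideal R) (t : R) (n k : ℕ)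
    (hn : (n : R) ∈ I) (ht : t ^ k - 1 ∈ I) : ∑ i ∈ Finset.range (n * k), t ^ i ∈ I := by
  have h1 : ∑ i ∈ Finset.range (n * k), t ^ i =
      (∑ i ∈ Finset.range k, t ^ i) * ∑ j ∈ Finset.range n, (t ^ k) ^ j := by
    clear hn
    induction n with
    | zero => simp
    | succ n ih =>
      rw [Nat.succ_mul, Finset.sum_range_add (fun i => t ^ i), ih, Finset.sum_range_succ,
        mul_add, Finset.sum_mul _ _ ((t ^ k) ^ n)]
      refine congrArg₂ _ rfl (Finset.sum_congr rfl fun i _ => ?_)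
      rw [← pow_mul, ← pow_add, mul_comm k n, add_comm]
  rw [h1]
  refine Ideal.mul_mem_left _ _ ?_
  rw [← Ideal.Quotient.eq_zero_iff_mem] at hn ⊢
  rw [← Ideal.Quotient.mk_eq_mk_iff_sub_mem, map_one, map_pow] at ht
  simpa [map_sum, ht] using hn

/-- X ^ k - 1 stays monic modulo n, so it is a nonzerodivisor there even when n is composite. -/
theorem natCast_dvd_of_dvd_X_pow_sub_one_mul {n k : ℕ} (hk : k ≠ 0) {r : ℤ[X]}
    (h : (n : ℤ[X]) ∣ (X ^ k - 1) * r) : (n : ℤ[X]) ∣ r := by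
  have key : ∀ s : ℤ[X], (n : ℤ[X]) ∣ s ↔ s.map (Int.castRingHom (ZMod n)) = 0 := by
    intro s
    rw [show (n : ℤ[X]) = C (n : ℤ) by simp, C_dvd_iff_dvd_coeff, Polynomial.ext_iff]
    simp [ZMod.intCast_zmod_eq_zero_iff_dvd, ZMod.intCast_zmod_eq_zero_iff_dvd]
  rw [key] at h ⊢
  have hm : (X ^ k - 1 : (ZMod n)[X]).Monic := monic_X_pow_sub_C 1 hk
  refine (hm.mul_right_eq_zero_iff).mp ?_
  simpa using h

theorem X_sub_one_dvd_sub_C_eval (f : BiPoly) : (X - 1 : BiPoly) ∣ f - C (f.eval 1) := by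
  simpa using X_sub_C_dvd_sub_C_eval (a := (1 : ℤ[X])) (p := f)

/-- a - 1 is a zero divisor at a fixed level, but its annihilator dies one level lower. Setting a =
1 shows that the coefficients of n and of b^{nk} - 1 can be adjusted by a multiple of the trivial
relation between these two elements so that both become divisible by a - 1. After cancellation,
a^{nk} - 1 turns into a geometric sum, which vanishes at level k. -/
theorem mem_levelIdeal_of_X_sub_one_mul_mem {n k : ℕ} (hn : n ≠ 0) (hk : k ≠ 0) {f : BiPoly}
    (h : (X - 1) * f ∈ levelIdeal n (n * k)) : f ∈ levelIdeal n k := by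
  obtain ⟨p, q, r, hf⟩ := mem_levelIdeal.mp h
  have h1 := congrArg (eval 1) hf
  simp only [eval_mul, eval_sub, eval_X, eval_one, sub_self, zero_mul, eval_add, eval_natCast,
    eval_pow, one_pow, eval_C, add_zero] at h1
  obtain ⟨s, hs⟩ := natCast_dvd_of_dvd_X_pow_sub_one_mul (mul_ne_zero hn hk)
    (Dvd.intro (-(p.eval 1)) (by linear_combination h1) :
      (n : ℤ[X]) ∣ (X ^ (n * k) - 1) * r.eval 1)
  have hp : p.eval 1 = -((X ^ (n * k) - 1) * s) := by
    have hn' : (n : ℤ[X]) ≠ 0 := by exact_mod_cast hn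
    apply mul_left_cancel₀ hn'
    rw [hs] at h1
    linear_combination -h1
  obtain ⟨p', hp'⟩ := X_sub_one_dvd_sub_C_eval p
  obtain ⟨r', hr'⟩ := X_sub_one_dvd_sub_C_eval r
  have hx : (X - 1 : BiPoly) ≠ 0 := X_sub_C_ne_zero (1 : ℤ[X])
  have hgeom : (X - 1 : BiPoly) * ∑ i ∈ Finset.range (n * k), X ^ i = X ^ (n * k) - 1 :=
    mul_geom_sum _ _
  have hfe :
      f = (n : BiPoly) * p' + (∑ i ∈ Finset.range (n * k), X ^ i) * q + (C X ^ (n * k) - 1) * r' := by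
    apply mul_left_cancel₀ hx
    rw [hf]
    have e1 : p = (X - 1) * p' - (C X ^ (n * k) - 1) * C s := by
      rw [hp] at hp'
      simp only [C_neg, C_mul, C_sub, C_pow, C_1] at hp'
      linear_combination hp'
    have e2 : r = (X - 1) * r' + (n : BiPoly) * C s := by
      rw [hs] at hr'
      simp only [C_mul, map_natCast] at hr'
      linear_combination hr'
    rw [e1, e2]
    linear_combination -q * hgeom
  rw [hfe]
  refine add_mem (add_mem (Ideal.mul_mem_right _ _ (natCast_mem_levelIdeal n k))
    (Ideal.mul_mem_right _ _ ?_)) (Ideal.mul_mem_right _ _ ?_)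
  · exact geom_sum_mem_of_pow_sub_one_mem _ _ _ _ (natCast_mem_levelIdeal n k)
      (X_pow_sub_one_mem_levelIdeal n k)
  · exact levelIdeal_le_of_dvd (Dvd.intro_left n rfl) (C_X_pow_sub_one_mem_levelIdeal n _)

/-- Exactness of the Koszul complex of `(a - 1, b - 1)`, up to a change of level. -/
theorem exists_koszul_lift {n k : ℕ} (hn : n ≠ 0) (hk : k ≠ 0) {f g : BiPoly}
    (h : (X - 1) * g - (C X - 1) * f ∈ levelIdeal n (n * (n * k))) :
    ∃ u : BiPoly, f - (X - 1) * u ∈ levelIdeal n k ∧ g - (C X - 1) * u ∈ levelIdeal n k := by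
  -- Setting a = 1 leaves a relation for f(1, b), and then b = 1 gives p(1, 1) = 0. Hence b - 1 can
  -- be cancelled, and f(1, b) lies in the ideal one factor n lower.
  obtain ⟨p, q, r, hf⟩ := mem_levelIdeal.mp h
  have h1 := congrArg (eval 1) hf
  simp only [eval_mul, eval_sub, eval_X, eval_one, sub_self, zero_mul, eval_add, eval_natCast,
    eval_pow, one_pow, eval_C, add_zero, zero_sub] at h1
  have h2 := congrArg (eval 1) h1
  simp only [eval_neg, eval_mul, eval_sub, eval_X, eval_one, sub_self, zero_mul, eval_add,
    eval_natCast, eval_pow, one_pow, add_zero, neg_zero] at h2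
  have h3 : (p.eval 1).eval 1 = 0 :=
    (mul_eq_zero.mp h2.symm).resolve_left (by exact_mod_cast hn)
  obtain ⟨p', hp'⟩ := dvd_iff_isRoot.mpr h3
  rw [C_1] at hp'
  have hy : (X - 1 : ℤ[X]) ≠ 0 := X_sub_C_ne_zero (1 : ℤ)
  have hgeom : (X - 1 : ℤ[X]) * ∑ i ∈ Finset.range (n * (n * k)), X ^ i = X ^ (n * (n * k)) - 1 :=
    mul_geom_sum _ _
  have hf1 : f.eval 1 =
      -((n : ℤ[X]) * p' + (∑ i ∈ Finset.range (n * (n * k)), X ^ i) * r.eval 1) := by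
    apply mul_left_cancel₀ hy
    rw [hp'] at h1
    linear_combination -h1 + r.eval 1 * hgeom
  obtain ⟨u, hu⟩ := X_sub_one_dvd_sub_C_eval f
  have hfu : f - (X - 1) * u ∈ levelIdeal n (n * k) := by
    have e : f - (X - 1) * u = -((n : BiPoly) * C p' +
        (∑ i ∈ Finset.range (n * (n * k)), (C X) ^ i) * C (r.eval 1)) := by
      rw [hf1] at hu
      simp only [C_neg, C_mul, C_add, map_natCast, map_sum, C_pow] at hu
      linear_combination hu
    rw [e]
    refine neg_mem (add_mem (Ideal.mul_mem_right _ _ (natCast_mem_levelIdeal _ _))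
      (Ideal.mul_mem_right _ _ ?_))
    exact geom_sum_mem_of_pow_sub_one_mem _ _ _ _ (natCast_mem_levelIdeal _ _)
      (C_X_pow_sub_one_mem_levelIdeal _ _)
  -- For g, the difference g - (b - 1)u is only controlled after multiplication by a - 1. Cancelling
  -- that factor costs the second n.
  refine ⟨u, levelIdeal_le_of_dvd (Dvd.intro_left n rfl) hfu,
    mem_levelIdeal_of_X_sub_one_mul_mem hn hk ?_⟩
  have e : (X - 1) * (g - (C X - 1) * u) =
      ((X - 1) * g - (C X - 1) * f) + (C X - 1) * (f - (X - 1) * u) := by ring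
  rw [e]
  exact add_mem (levelIdeal_le_of_dvd (Dvd.intro_left n rfl) h) (Ideal.mul_mem_left _ _ hfu)

/-- The images of both variables are roots of X ^ k - 1, so S is integral and of finite type over ℤ,
hence a finitely generated abelian group; it is killed by n. -/
theorem finite_of_surjective_biPoly {S : Type*} [CommRing S] (π : BiPoly →+* S)
    (hπ : Function.Surjective π) {n k : ℕ} (hn : n ≠ 0) (hk : k ≠ 0) (hn0 : (n : S) = 0)
    (ha : π X ^ k = 1) (hb : π (C X) ^ k = 1) : Finite S := by
  have hint : ∀ t : S, t ^ k = 1 → IsIntegral ℤ t := fun t ht =>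
    ⟨X ^ k - 1, monic_X_pow_sub_C 1 hk, by simp [ht]⟩
  have hI : Algebra.IsIntegral ℤ S := by
    constructor
    intro z
    obtain ⟨f, rfl⟩ := hπ z
    induction f using Polynomial.induction_on' with
    | add p q hp hq => rw [map_add]; exact hp.add hq
    | monomial i c =>
      rw [← C_mul_X_pow_eq_monomial, map_mul, map_pow]
      refine IsIntegral.mul ?_ ((hint _ ha).pow i)
      induction c using Polynomial.induction_on' with
      | add p q hp hq => rw [map_add, map_add]; exact hp.add hq
      | monomial j d =>
        rw [← C_mul_X_pow_eq_monomial, map_mul, map_mul, map_pow, map_pow]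
        refine IsIntegral.mul ?_ ((hint _ hb).pow j)
        rw [show C (C d : ℤ[X]) = ((d : ℤ) : BiPoly) by simp, map_intCast]
        exact isIntegral_algebraMap (R := ℤ) (x := d)
  have hF : Algebra.FiniteType ℤ S :=
    Algebra.FiniteType.of_surjective (R := ℤ) (A := BiPoly) π.toIntAlgHom hπ
  have hM : Module.Finite ℤ S := Algebra.IsIntegral.finite
  refine Module.finite_of_fg_torsion S fun x => ?_
  refine ⟨⟨(n : ℤ), mem_nonZeroDivisors_of_ne_zero (by exact_mod_cast hn)⟩, ?_⟩
  change (n : ℤ) • x = 0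
  rw [zsmul_eq_mul, Int.cast_natCast, hn0, zero_mul]

/-- The units of ℤ[a^{±1}, b^{±1}] are ± monomials, stated without denominators. It follows from a
and b being prime in ℤ[b][a]. -/
theorem eq_monomial_of_mul_eq_monomial {f g : BiPoly} {p q : ℕ}
    (h : f * g = X ^ p * C X ^ q) :
    ∃ i j : ℕ, ∃ ε : ℤˣ, f = ((ε : ℤ) : BiPoly) * (X ^ i * C X ^ j) := by
  obtain ⟨f₁, f₂, h₁, h₂, rfl⟩ := exists_dvd_and_dvd_of_dvd_mul (Dvd.intro g h)
  obtain ⟨i, -, hi⟩ := (dvd_prime_pow prime_X p).mp h₁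
  obtain ⟨j, -, hj⟩ := (dvd_prime_pow (prime_C_iff.mpr prime_X) q).mp h₂
  obtain ⟨u, hu⟩ := hi.symm.mul_mul hj.symm
  obtain ⟨c, hc, hcu⟩ := Polynomial.isUnit_iff.mp u.isUnit
  obtain ⟨d, hd, rfl⟩ := Polynomial.isUnit_iff.mp hc
  refine ⟨i, j, hd.unit, ?_⟩
  rw [← hu, ← hcu, mul_comm]
  simp

end Bivariate

/-! ### Evaluation of bivariate polynomials at commuting elements -/

section Evaluation

open Polynomial

/-- Evaluation of polynomials in `ℤ[b][a]` at commuting elements `x` and `y`. -/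
noncomputable def biEval {E : Type*} [Ring E] (x y : E) (h : Commute x y) : BiPoly →+* E :=
  eval₂RingHom' (eval₂RingHom' (Int.castRingHom E) y fun n => Int.cast_commute n y) x fun p => by
    induction p using Polynomial.induction_on' with
    | add p q hp hq => rw [map_add]; exact hp.add_left hq
    | monomial n c =>
      change Commute (eval₂ _ y (monomial n c)) x
      rw [eval₂_monomial]
      exact (Int.cast_commute c x).mul_left (h.symm.pow_left n)

variable {E E' : Type*} [Ring E] [Ring E'] {x y : E} {x' y' : E'}

@[simp]
theorem biEval_X (h : Commute x y) : biEval x y h X = x :=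
  eval₂_X _ _

@[simp]
theorem biEval_C_X (h : Commute x y) : biEval x y h (C X) = y :=
  (eval₂_C _ _).trans (eval₂_X _ _)

/-- Applied below to inclusions of stable subgroups, to maps between derived subgroups, and to the
translation part of an affine representation. -/
theorem map_biEval_smul {B B' : Type*} [AddCommGroup B] [AddCommGroup B'] [Module E B]
    [Module E' B']
    (h : Commute x y) (h' : Commute x' y') (J : B →+ B') (hx : ∀ m, J (x • m) = x' • J m)
    (hy : ∀ m, J (y • m) = y' • J m) (p : BiPoly) (m : B) :
    J (biEval x y h p • m) = biEval x' y' h' p • J m := by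
  have hpow : ∀ (e : E) (e' : E'), (∀ m, J (e • m) = e' • J m) → ∀ (i : ℕ) (m : B),
      J (e ^ i • m) = e' ^ i • J m := by
    intro e e' he i
    induction i with
    | zero => simp
    | succ i ih => intro m; rw [pow_succ, mul_smul, ih, he, pow_succ, mul_smul]
  have hC : ∀ (q : ℤ[X]) (m : B), J (biEval x y h (C q) • m) = biEval x' y' h' (C q) • J m := by
    intro q
    induction q using Polynomial.induction_on' with
    | add p q hp hq => intro m; simp only [map_add, add_smul, hp, hq]
    | monomial i c =>
      intro m
      have hc : C (C c : ℤ[X]) = ((c : ℤ) : BiPoly) := by simp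
      rw [← C_mul_X_pow_eq_monomial, C_mul, C_pow, hc, map_mul, map_mul, map_pow, map_pow,
        map_intCast, map_intCast, biEval_C_X, biEval_C_X, mul_smul, mul_smul,
        Int.cast_smul_eq_zsmul, Int.cast_smul_eq_zsmul, map_zsmul, hpow y y' hy]
  induction p using Polynomial.induction_on' generalizing m with
  | add p q hp hq => simp only [map_add, add_smul, hp, hq]
  | monomial i q =>
    rw [← C_mul_X_pow_eq_monomial, map_mul, map_mul, map_pow, map_pow, biEval_X, biEval_X, mul_smul,
      mul_smul, hC, hpow x x' hx]

end Evaluation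

/-! ### The conjugation action on an abelian normal subgroup -/

section ConjAction

open Polynomial
open scoped IsMulCommutative commutatorElement

variable {G : Type*} [Group G] (N : Subgroup G)

theorem coe_toMul_injective : Function.Injective fun m : Additive N => (m.toMul : G) :=
  Subtype.val_injective

theorem coe_toMul_add (m m' : Additive N) : ((m + m').toMul : G) = m.toMul * m'.toMul := rfl

variable [N.Normal]

/-- Conjugation by `g` as an endomorphism of the abelian normal subgroup `N`. -/
def conjEnd (g : G) : AddMonoid.End (Additive N) :=
  MonoidHom.toAdditive (MulAut.conjNormal g : MulAut N).toMonoidHom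

theorem coe_conjEnd (g : G) (m : Additive N) :
    ((conjEnd N g m).toMul : G) = g * (m.toMul : G) * g⁻¹ := rfl

theorem conjEnd_mul (g h : G) : conjEnd N (g * h) = conjEnd N g * conjEnd N h := by
  ext m
  change g * h * (m.toMul : G) * (g * h)⁻¹ = g * (h * m.toMul * h⁻¹) * g⁻¹
  group

theorem conjEnd_pow (g : G) (i : ℕ) : conjEnd N (g ^ i) = conjEnd N g ^ i := by
  induction i with
  | zero =>
    rw [pow_zero, pow_zero]
    ext m
    change 1 * (m.toMul : G) * 1⁻¹ = m.toMul
    group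
  | succ i ih => rw [pow_succ, pow_succ, conjEnd_mul, ih]

variable [IsMulCommutative N]

/-- N is abelian and so acts trivially on itself; conjugation depends only on the class in G/N. -/
theorem conjEnd_eq_of_mul_inv_mem {g h : G} (hgh : g * h⁻¹ ∈ N) : conjEnd N g = conjEnd N h := by
  have h1 : ∀ n ∈ N, conjEnd N n = 1 := by
    intro n hn
    ext m
    change n * (m.toMul : G) * n⁻¹ = m.toMul
    rw [setLike_mul_comm hn m.toMul.2, mul_inv_cancel_right]
  rw [← inv_mul_cancel_right g h, conjEnd_mul, h1 _ hgh, one_mul]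

theorem commute_conjEnd {g h : G} (hgh : ⁅g, h⁆ ∈ N) : Commute (conjEnd N g) (conjEnd N h) := by
  rw [Commute, SemiconjBy, ← conjEnd_mul, ← conjEnd_mul]
  refine conjEnd_eq_of_mul_inv_mem N ?_
  rwa [commutatorElement_def, mul_assoc (g * h), ← mul_inv_rev] at hgh

variable {g₁ g₂ : G} (hc : ⁅g₁, g₂⁆ ∈ N)

/-- The action of `ℤ[b][a]` on `N`, where `a` acts by conjugation by `g₁` and `b` by conjugation
by `g₂`. -/
noncomputable def polyAct : BiPoly →+* AddMonoid.End (Additive N) :=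
  biEval (conjEnd N g₁) (conjEnd N g₂) (commute_conjEnd N hc)

@[simp]
theorem polyAct_X : polyAct N hc X = conjEnd N g₁ := biEval_X _

@[simp]
theorem polyAct_C_X : polyAct N hc (C X) = conjEnd N g₂ := biEval_C_X _

theorem polyAct_mul_apply (p q : BiPoly) (m : Additive N) :
    polyAct N hc (p * q) m = polyAct N hc p (polyAct N hc q m) := by
  rw [map_mul]
  rfl

theorem polyAct_add_apply (p q : BiPoly) (m : Additive N) :
    polyAct N hc (p + q) m = polyAct N hc p m + polyAct N hc q m := by
  rw [map_add]
  rfl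

theorem polyAct_sub_apply (p q : BiPoly) (m : Additive N) :
    polyAct N hc (p - q) m = polyAct N hc p m - polyAct N hc q m := by
  rw [map_sub]
  rfl

theorem polyAct_monomial (i j : ℕ) :
    polyAct N hc (X ^ i * C X ^ j) = conjEnd N (g₁ ^ i * g₂ ^ j) := by
  rw [map_mul, map_pow, map_pow, polyAct_X, polyAct_C_X, conjEnd_mul, conjEnd_pow, conjEnd_pow]

/-- The commutator of the two distinguished elements, as an element of `N`. -/
def commElt : Additive N := Additive.ofMul ⟨⁅g₁, g₂⁆, hc⟩

/-- Every subgroup that is normalized by `g` contains the orbits of the action of polynomials in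
`g`. -/
theorem polyAct_mem {U : AddSubgroup (Additive N)} (h₁ : ∀ m ∈ U, conjEnd N g₁ m ∈ U)
    (h₂ : ∀ m ∈ U, conjEnd N g₂ m ∈ U) (p : BiPoly) {m : Additive N} (hm : m ∈ U) :
    polyAct N hc p m ∈ U := by
  let u₁ : AddMonoid.End U := ((conjEnd N g₁).comp U.subtype).codRestrict U fun m => h₁ _ m.2
  let u₂ : AddMonoid.End U := ((conjEnd N g₂).comp U.subtype).codRestrict U fun m => h₂ _ m.2
  have hu : Commute u₁ u₂ := by
    ext m
    exact congrArg (fun x : Additive N => (x.toMul : G))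
      (DFunLike.congr_fun (commute_conjEnd N hc) (m : Additive N))
  have := map_biEval_smul hu (commute_conjEnd N hc) U.subtype (fun _ => rfl)
    (fun _ => rfl) p ⟨m, hm⟩
  change _ = polyAct N hc p m at this
  rw [← this]
  exact SetLike.coe_mem _

theorem commute_of_closure_eq_top {Q : Type*} [Group Q] {q₁ q₂ : Q}
    (htop : Subgroup.closure {q₁, q₂} = ⊤) (h : Commute q₁ q₂) (x y : Q) : Commute x y := by
  have h1 : (⊤ : Subgroup Q) ≤ Subgroup.centralizer {q₁, q₂} := by
    rw [← htop, Subgroup.closure_le]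
    rintro z (rfl | rfl) w (rfl | rfl)
    · rfl
    · exact h.symm
    · exact h
    · rfl
  have h2 : (⊤ : Subgroup Q) ≤ Subgroup.center Q := by
    rw [← htop, Subgroup.closure_le]
    intro z hz
    exact Subgroup.mem_center_iff.mpr fun w => (h1 (Subgroup.mem_top w) z hz).symm
  exact (Subgroup.mem_center_iff.mp (h2 (Subgroup.mem_top x)) y).symm

/-- In a group generated by `g₁` and `g₂` whose commutator subgroup is abelian, every element of the
commutator subgroup is, up to conjugation, the image of `[g₁, g₂]` under a polynomial. -/
theorem exists_polyAct_commElt (htop : Subgroup.closure {g₁, g₂} = ⊤)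
    {m : Additive N} (hm : (m.toMul : G) ∈ commutator G) :
    ∃ (i j : ℕ) (f : BiPoly),
      polyAct N hc (X ^ i * C X ^ j) m = polyAct N hc f (commElt N hc) := by
  -- The monomial clears denominators, since only a and b, not their inverses, are available. The
  -- subgroup L is normal and contains [g₁, g₂], so G/L is generated by two commuting elements and L
  -- contains the derived subgroup.
  let L : Subgroup G :=
    { carrier := {g | ∃ m : Additive N, (m.toMul : G) = g ∧ ∃ (i j : ℕ) (f : BiPoly),
        polyAct N hc (X ^ i * C X ^ j) m = polyAct N hc f (commElt N hc)}
      one_mem' := ⟨0, rfl, 0, 0, 0, by rw [map_zero, map_zero]; rfl⟩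
      mul_mem' := by
        rintro _ _ ⟨m, rfl, i, j, f, h⟩ ⟨m', rfl, i', j', f', h'⟩
        refine ⟨m + m', rfl, i + i', j + j', X ^ i' * C X ^ j' * f + X ^ i * C X ^ j * f', ?_⟩
        rw [polyAct_add_apply, polyAct_mul_apply N hc _ f, polyAct_mul_apply N hc _ f', ← h, ← h',
          map_add, ← polyAct_mul_apply, ← polyAct_mul_apply]
        congr 3 <;> ring
      inv_mem' := by
        rintro _ ⟨m, rfl, i, j, f, h⟩
        refine ⟨-m, rfl, i, j, -f, ?_⟩
        rw [map_neg, h, map_neg]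
        rfl }
  have hL : L.Normal := by
    rw [← Subgroup.normalizer_eq_top_iff, ← top_le_iff, ← htop, Subgroup.closure_le]
    rintro g (rfl | rfl)
    all_goals
      refine Subgroup.mem_normalizer_iff.mpr fun k => ⟨?_, ?_⟩
    · rintro ⟨m, rfl, i, j, f, h⟩
      refine ⟨conjEnd N g m, rfl, i, j, X * f, ?_⟩
      rw [polyAct_mul_apply N hc X, ← h, ← polyAct_mul_apply, mul_comm X, polyAct_mul_apply _ _ _ X,
        polyAct_X]
    -- Conjugation by g₁⁻¹ costs one more power of a in the denominator.
    · rintro ⟨m, hm, i, j, f, h⟩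
      have hk : k ∈ N := by
        have := (inferInstance : N.Normal).conj_mem _ m.toMul.2 g⁻¹
        rw [hm] at this
        simpa [mul_assoc] using this
      refine ⟨Additive.ofMul ⟨k, hk⟩, rfl, i + 1, j, f, ?_⟩
      rw [← h, show (X ^ (i + 1) * C X ^ j : BiPoly) = X ^ i * C X ^ j * X by ring,
        polyAct_mul_apply, polyAct_X]
      congr 1
      exact coe_toMul_injective N hm.symm
    · rintro ⟨m, rfl, i, j, f, h⟩
      refine ⟨conjEnd N g m, rfl, i, j, C X * f, ?_⟩
      rw [polyAct_mul_apply N hc (C X), ← h, ← polyAct_mul_apply, mul_comm (C X : BiPoly),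
        polyAct_mul_apply _ _ _ (C X), polyAct_C_X]
    · rintro ⟨m, hm, i, j, f, h⟩
      have hk : k ∈ N := by
        have := (inferInstance : N.Normal).conj_mem _ m.toMul.2 g⁻¹
        rw [hm] at this
        simpa [mul_assoc] using this
      refine ⟨Additive.ofMul ⟨k, hk⟩, rfl, i, j + 1, f, ?_⟩
      rw [← h, show (X ^ i * C X ^ (j + 1) : BiPoly) = X ^ i * C X ^ j * C X by ring,
        polyAct_mul_apply, polyAct_C_X]
      congr 1
      exact coe_toMul_injective N hm.symm
  have hcL : ⁅g₁, g₂⁆ ∈ L := ⟨commElt N hc, rfl, 0, 0, 1, by simp⟩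
  have hQ : Subgroup.closure {(g₁ : G ⧸ L), (g₂ : G ⧸ L)} = ⊤ := by
    have h1 := congrArg (Subgroup.map (QuotientGroup.mk' L)) htop
    rw [MonoidHom.map_closure, Set.image_pair,
      Subgroup.map_top_of_surjective _ (QuotientGroup.mk'_surjective L)] at h1
    exact h1
  have hcomm : Commute (g₁ : G ⧸ L) (g₂ : G ⧸ L) := by
    rw [← commutatorElement_eq_one_iff_commute]
    exact (QuotientGroup.eq_one_iff _).mpr hcL
  have hle : commutator G ≤ L := by
    rw [commutator_def, Subgroup.commutator_le]
    intro p _ q _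
    rw [← QuotientGroup.eq_one_iff]
    exact commutatorElement_eq_one_iff_commute.mpr (commute_of_closure_eq_top hQ hcomm p q)
  obtain ⟨m', hm', i, j, f, h⟩ := hle hm
  rw [coe_toMul_injective N hm'] at h
  exact ⟨i, j, f, h⟩

/-- This turns a condition on the images of the generators into a linear equation over ℤ[a, b]: if
the commutator is unchanged, then (a - 1)n₂ = (b - 1)n₁. -/
theorem commutatorElement_mul_mul (n₁ n₂ : Additive N) :
    ⁅(n₁.toMul : G) * g₁, (n₂.toMul : G) * g₂⁆ =
      ((commElt N hc + polyAct N hc (X - 1) n₂ - polyAct N hc (C X - 1) n₁).toMul : G) := by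
  have h1 : commElt N hc + polyAct N hc (X - 1) n₂ - polyAct N hc (C X - 1) n₁ =
      n₁ + conjEnd N g₁ n₂ + commElt N hc + -(conjEnd N g₂ n₁) + -n₂ := by
    rw [polyAct_sub_apply, polyAct_sub_apply, polyAct_X, polyAct_C_X, map_one,
      AddMonoid.End.one_apply, AddMonoid.End.one_apply]
    abel
  rw [h1]
  change _ = (n₁.toMul : G) * (g₁ * n₂.toMul * g₁⁻¹) * (g₁ * g₂ * g₁⁻¹ * g₂⁻¹) *
    (g₂ * n₁.toMul * g₂⁻¹)⁻¹ * (n₂.toMul : G)⁻¹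
  rw [commutatorElement_def]
  group

end ConjAction

/-! ### Affine groups -/

section Affine

/-- The affine group of a commutative ring `S`: the group of maps `s ↦ u * s + t`. -/
@[ext]
structure Aff (S : Type*) [CommRing S] where
  /-- The linear part. -/
  u : Sˣ
  /-- The translation part. -/
  t : S

namespace Aff

variable {S : Type*} [CommRing S]

instance : Mul (Aff S) := ⟨fun x y => ⟨x.u * y.u, x.t + x.u * y.t⟩⟩
instance : One (Aff S) := ⟨⟨1, 0⟩⟩
instance : Inv (Aff S) := ⟨fun x => ⟨x.u⁻¹, -(↑x.u⁻¹ * x.t)⟩⟩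

@[simp] theorem mul_u (x y : Aff S) : (x * y).u = x.u * y.u := rfl
@[simp] theorem mul_t (x y : Aff S) : (x * y).t = x.t + x.u * y.t := rfl
@[simp] theorem one_u : (1 : Aff S).u = 1 := rfl
@[simp] theorem one_t : (1 : Aff S).t = 0 := rfl
@[simp] theorem inv_u (x : Aff S) : x⁻¹.u = x.u⁻¹ := rfl
@[simp] theorem inv_t (x : Aff S) : x⁻¹.t = -(↑x.u⁻¹ * x.t) := rfl

instance : Group (Aff S) :=
  Group.ofLeftAxioms
    (fun x y z => Aff.ext (mul_assoc _ _ _) (by simp only [mul_t, mul_u, Units.val_mul]; ring))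
    (fun x => Aff.ext (one_mul _) (by simp))
    (fun x => Aff.ext (inv_mul_cancel _) (by simp))

/-- The linear part of an affine map. -/
def linear : Aff S →* Sˣ where
  toFun := Aff.u
  map_one' := rfl
  map_mul' _ _ := rfl

instance [Finite S] : Finite (Aff S) :=
  Finite.of_injective (fun x : Aff S => (x.u, x.t)) fun _ _ h =>
    Aff.ext (congrArg Prod.fst h) (congrArg Prod.snd h)

theorem isMulCommutative_ker_linear : ∀ x ∈ (linear (S := S)).ker, ∀ y ∈ (linear (S := S)).ker,
    x * y = y * x := by
  intro x hx y hy
  have hx' : x.u = 1 := hx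
  have hy' : y.u = 1 := hy
  ext
  · rw [mul_u, mul_u, mul_comm]
  · simp [hx', hy', add_comm]

end Aff

open Polynomial
open scoped IsMulCommutative commutatorElement

variable {G : Type*} [Group G] (N : Subgroup G) [N.Normal] [IsMulCommutative N] {g₁ g₂ : G}
  (hc : ⁅g₁, g₂⁆ ∈ N)

/-- A Magnus-type representation: the commutator of s ↦ as and s ↦ bs + 1 is translation by a - 1,
and conjugation acts on translations through the linear part. It detects the annihilator of [g₁, g₂]
up to the factor a - 1. -/
theorem aff_polyAct_commElt {S : Type*} [CommRing S] (μ : G →* Aff S) (hN : ∀ m ∈ N, (μ m).u = 1)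
    (a b : Sˣ) (h₁ : μ g₁ = ⟨a, 0⟩) (h₂ : μ g₂ = ⟨b, 1⟩) (p : BiPoly) :
    (μ (polyAct N hc p (commElt N hc)).toMul).t =
      biEval (a : S) (b : S) (Commute.all _ _) (p * (X - 1)) := by
  let J : Additive N →+ S :=
    { toFun := fun m => (μ m.toMul).t
      map_zero' := by simp
      map_add' := fun m m' => by
        rw [coe_toMul_add, map_mul, Aff.mul_t, hN _ m.toMul.2, Units.val_one, one_mul] }
  have h := map_biEval_smul (commute_conjEnd N hc) (Commute.all (a : S) (b : S)) J
    (fun m => by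
      change (μ (g₁ * m.toMul * g₁⁻¹)).t = a * (μ m.toMul).t
      simp [h₁])
    (fun m => by
      change (μ (g₂ * m.toMul * g₂⁻¹)).t = b * (μ m.toMul).t
      simp [h₂, hN _ m.toMul.2]) p (commElt N hc)
  change (μ (polyAct N hc p (commElt N hc)).toMul).t = _ • (μ ⁅g₁, g₂⁆).t at h
  rw [h, map_mul, map_sub, map_one, biEval_X, smul_eq_mul, commutatorElement_def]
  have hab : (a : S) * (b * (↑a⁻¹ * ↑b⁻¹)) = 1 := by
    rw [mul_left_comm (b : S), ← mul_assoc (a : S)]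
    simp
  simp [h₁, h₂, mul_assoc, sub_eq_add_neg, mul_add, hab]

end Affine

/-! ### Automorphisms acting trivially on the abelianization of a metabelian group -/

section IA

open Polynomial
open scoped IsMulCommutative commutatorElement

variable {G : Type*} [Group G] {g₁ g₂ : G}

theorem commutatorElement_mem_commutator (x y : G) : ⁅x, y⁆ ∈ commutator G :=
  Subgroup.commutator_mem_commutator (Subgroup.mem_top x) (Subgroup.mem_top y)

/-- The homomorphism between subgroups `N` and `N'` induced by a homomorphism of groups, written
additively. -/
def mapSubgroup {G' : Type*} [Group G'] (N : Subgroup G) (N' : Subgroup G') (f : G →* G')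
    (h : ∀ m ∈ N, f m ∈ N') : Additive N →+ Additive N' :=
  MonoidHom.toAdditive ((f.comp N.subtype).codRestrict N' fun m => h m m.2)

theorem coe_mapSubgroup {G' : Type*} [Group G'] (N : Subgroup G) (N' : Subgroup G') (f : G →* G')
    (h : ∀ m ∈ N, f m ∈ N') (m : Additive N) :
    ((mapSubgroup N N' f h m).toMul : G') = f m.toMul := rfl

theorem mapSubgroup_polyAct {G' : Type*} [Group G'] {g₁' g₂' : G'} (N : Subgroup G) [N.Normal]
    [IsMulCommutative N] (N' : Subgroup G') [N'.Normal] [IsMulCommutative N']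
    (hc : ⁅g₁, g₂⁆ ∈ N) (hc' : ⁅g₁', g₂'⁆ ∈ N') (f : G →* G') (h : ∀ m ∈ N, f m ∈ N')
    (h₁ : f g₁ * g₁'⁻¹ ∈ N') (h₂ : f g₂ * g₂'⁻¹ ∈ N') (p : BiPoly) (m : Additive N) :
    mapSubgroup N N' f h (polyAct N hc p m) = polyAct N' hc' p (mapSubgroup N N' f h m) := by
  have key : ∀ g g', f g * g'⁻¹ ∈ N' → ∀ m : Additive N,
      mapSubgroup N N' f h (conjEnd N g m) = conjEnd N' g' (mapSubgroup N N' f h m) := by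
    intro g g' hg m
    rw [← DFunLike.congr_fun (conjEnd_eq_of_mul_inv_mem N' hg) (mapSubgroup N N' f h m)]
    apply coe_toMul_injective
    simp only [coe_mapSubgroup, coe_conjEnd, map_mul, map_inv]
  exact map_biEval_smul (commute_conjEnd N hc) (commute_conjEnd N' hc') (mapSubgroup N N' f h)
    (key g₁ g₁' h₁) (key g₂ g₂' h₂) p m

theorem map_mem_commutator (φ : MulAut G) (m : G) (hm : m ∈ commutator G) :
    φ m ∈ commutator G := by
  have h : (commutator G).map φ.toMonoidHom ≤ commutator G := by
    rw [commutator_def, Subgroup.map_commutator]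
    exact Subgroup.commutator_mono le_top le_top
  exact h ⟨m, hm, rfl⟩

/-- In a metabelian group generated by `g₁` and `g₂` in which `[g₁, g₂]` has trivial annihilator, an
automorphism that acts trivially on the abelianization maps `[g₁, g₂]` to a conjugate. -/
theorem exists_conj_commutatorElement [IsMulCommutative (commutator G)]
    (htop : Subgroup.closure {g₁, g₂} = ⊤)
    (hann : ∀ p : BiPoly, polyAct (commutator G) (commutatorElement_mem_commutator g₁ g₂) p
      (commElt _ (commutatorElement_mem_commutator g₁ g₂)) = 0 → p = 0)
    (φ : MulAut G) (h₁ : φ g₁ * g₁⁻¹ ∈ commutator G) (h₂ : φ g₂ * g₂⁻¹ ∈ commutator G) :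
    ∃ g : G, φ ⁅g₁, g₂⁆ = g * ⁅g₁, g₂⁆ * g⁻¹ := by
  set N := commutator G with hN
  have hc : ⁅g₁, g₂⁆ ∈ N := commutatorElement_mem_commutator g₁ g₂
  set c := commElt N hc
  have hinj : ∀ p q : BiPoly, polyAct N hc p c = polyAct N hc q c → p = q := by
    intro p q h
    rw [← sub_eq_zero]
    exact hann _ (by rw [polyAct_sub_apply, h, sub_self])
  -- φ moves each generator only by an element of N, so J is linear over ℤ[a, b], and likewise for
  -- J' and φ⁻¹.
  let J := mapSubgroup N N φ.toMonoidHom (map_mem_commutator φ)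
  let J' := mapSubgroup N N (φ⁻¹ : MulAut G).toMonoidHom (map_mem_commutator φ⁻¹)
  have hJJ' : J (J' c) = c := coe_toMul_injective N (φ.apply_symm_apply _)
  have hJ := mapSubgroup_polyAct N N hc hc φ.toMonoidHom (map_mem_commutator φ) h₁ h₂
  obtain ⟨i, j, f, hf⟩ := exists_polyAct_commElt N hc htop (J c).toMul.2
  obtain ⟨i', j', f', hf'⟩ := exists_polyAct_commElt N hc htop (J' c).toMul.2
  change polyAct N hc _ (J c) = _ at hf
  change polyAct N hc _ (J' c) = _ at hf'
  have hf'' := congrArg J hf'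
  rw [hJ, hJ] at hf''
  change polyAct N hc _ (J (J' c)) = polyAct N hc _ (J c) at hf''
  rw [hJJ'] at hf''
  -- Up to monomials, J and J' multiply c by f and f'. As J J' c = c, f becomes a unit among Laurent
  -- polynomials.
  have hmul : f * f' = X ^ (i + i') * C X ^ (j + j') := by
    apply hinj
    rw [mul_comm, polyAct_mul_apply, ← hf, ← polyAct_mul_apply, mul_comm, polyAct_mul_apply, ← hf'',
      ← polyAct_mul_apply]
    congr 2
    ring
  obtain ⟨k, l, ε, hε⟩ := eq_monomial_of_mul_eq_monomial hmul
  let n₁ : Additive N := Additive.ofMul ⟨_, h₁⟩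
  let n₂ : Additive N := Additive.ofMul ⟨_, h₂⟩
  obtain ⟨i₁, j₁, f₁, hf₁⟩ := exists_polyAct_commElt N hc htop (m := n₁) h₁
  obtain ⟨i₂, j₂, f₂, hf₂⟩ := exists_polyAct_commElt N hc htop (m := n₂) h₂
  have hJc : J c = c + polyAct N hc (X - 1) n₂ - polyAct N hc (C X - 1) n₁ := by
    apply coe_toMul_injective N
    dsimp only
    rw [← commutatorElement_mul_mul]
    change φ ⁅g₁, g₂⁆ = ⁅φ g₁ * g₁⁻¹ * g₁, φ g₂ * g₂⁻¹ * g₂⁆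
    rw [inv_mul_cancel_right, inv_mul_cancel_right, map_commutatorElement]
  -- The formula for J c with all denominators cleared; s and t stand for a - 1 and b - 1.
  have hrel : ∀ s t : BiPoly, J c = c + polyAct N hc s n₂ - polyAct N hc t n₁ →
      (X ^ i₁ * C X ^ j₁) * (X ^ i₂ * C X ^ j₂) * f =
      (X ^ i₁ * C X ^ j₁) * (X ^ i₂ * C X ^ j₂) * (X ^ i * C X ^ j) +
        s * (X ^ i * C X ^ j) * (X ^ i₁ * C X ^ j₁) * f₂ -
        t * (X ^ i * C X ^ j) * (X ^ i₂ * C X ^ j₂) * f₁ := by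
    intro s t hst
    apply hinj
    rw [polyAct_mul_apply, ← hf, hst, polyAct_sub_apply, polyAct_add_apply,
      polyAct_mul_apply N hc _ f₁, polyAct_mul_apply N hc _ f₂, ← hf₁, ← hf₂]
    generalize (X ^ i * C X ^ j : BiPoly) = m
    generalize (X ^ i₁ * C X ^ j₁ : BiPoly) = m₁
    generalize (X ^ i₂ * C X ^ j₂ : BiPoly) = m₂
    rw [map_sub, map_sub, map_add, map_add, ← polyAct_mul_apply, ← polyAct_mul_apply,
      ← polyAct_mul_apply, ← polyAct_mul_apply, ← polyAct_mul_apply, ← polyAct_mul_apply,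
      ← polyAct_mul_apply, show m₁ * m₂ * m * s = s * m * m₁ * m₂ by ring,
      show m₁ * m₂ * m * t = t * m * m₂ * m₁ by ring]
  -- At a = b = 1 the terms with factors a - 1 and b - 1 vanish, leaving ε = 1.
  have hε1 : (ε : ℤ) = 1 := by
    have h := congrArg (fun p : BiPoly => (p.eval 1).eval 1) (hrel _ _ hJc)
    simpa [hε] using h
  refine ⟨(g₁ ^ i * g₂ ^ j)⁻¹ * (g₁ ^ k * g₂ ^ l), ?_⟩
  rw [hε, hε1, Int.cast_one, one_mul, polyAct_monomial, polyAct_monomial] at hf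
  have h := congrArg (fun m : Additive N => (m.toMul : G)) hf
  change (g₁ ^ i * g₂ ^ j) * φ ⁅g₁, g₂⁆ * (g₁ ^ i * g₂ ^ j)⁻¹ =
    (g₁ ^ k * g₂ ^ l) * ⁅g₁, g₂⁆ * (g₁ ^ k * g₂ ^ l)⁻¹ at h
  rw [mul_inv_eq_iff_eq_mul, ← eq_inv_mul_iff_mul_eq] at h
  rw [h]
  group

end IA

/-! ### Structure of the free profinite metabelian group -/

section MHat

open Topology
open scoped commutatorElement

/-- The generators of `MHat`. -/
noncomputable def gen (i : Fin 2) : MHat := toMHat (FreeGroup.of i)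

/-- The kernel of the abelianization `MHat → ZHat²`, i.e. the closed commutator subgroup. -/
noncomputable def NHat : Subgroup MHat := coordMHat.toMonoidHom.ker

instance : NHat.Normal := MonoidHom.normal_ker _

theorem mem_NHat {g : MHat} : g ∈ NHat ↔ coordMHat g = 1 := Iff.rfl

theorem commutatorElement_mem_NHat (a b : MHat) : ⁅a, b⁆ ∈ NHat :=
  Abelianization.commutator_subset_ker coordMHat.toMonoidHom (commutatorElement_mem_commutator a b)

theorem NHat_le_topologicalClosure :
    NHat ≤ ((commutator F).map toMHat).topologicalClosure := by
  rw [NHat, ker_coordMHat]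
  refine Subgroup.topologicalClosure_minimal _ ?_ (Subgroup.isClosed_topologicalClosure _)
  rw [commutator_def, Subgroup.commutator_le]
  intro a _ b _
  refine isClosed_property2
    (p := fun a b => ⁅a, b⁆ ∈ ((commutator F).map toMHat).topologicalClosure)
    denseRange_toMHat ?_ ?_ a b
  · refine (Subgroup.isClosed_topologicalClosure _).preimage
      (f := fun q : MHat × MHat => ⁅q.1, q.2⁆) ?_
    simp only [commutatorElement_def]
    fun_prop
  · intro u v
    refine Subgroup.le_topologicalClosure _ ⟨⁅u, v⁆, commutatorElement_mem_commutator u v, ?_⟩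
    exact map_commutatorElement _ _ _

theorem toMHat_eq_one_of_mem {w : F} (hw : w ∈ derivedSeries F 2) : toMHat w = 1 := by
  rw [toMHat, MonoidHom.comp_apply, QuotientGroup.mk'_apply, (QuotientGroup.eq_one_iff w).mpr hw,
    map_one]

/-- The image of F' in `MHat` is commutative because F'' maps to 1. It is dense in `NHat`, and
commuting is a closed condition. -/
instance : IsMulCommutative NHat := by
  refine IsMulCommutative.of_setLike_mul_comm fun a ha b hb => ?_
  have key : ∀ a ∈ closure (toMHat '' (commutator F : Set F)),
      ∀ b ∈ closure (toMHat '' (commutator F : Set F)), a * b = b * a := by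
    intro a ha b hb
    refine closure_minimal (t := {q : MHat × MHat | q.1 * q.2 = q.2 * q.1}) ?_
      (isClosed_eq (by fun_prop) (by fun_prop))
      (show (a, b) ∈ closure ((toMHat '' (commutator F : Set F)) ×ˢ
        (toMHat '' (commutator F : Set F))) by rw [closure_prod_eq]; exact ⟨ha, hb⟩)
    rintro ⟨_, _⟩ ⟨⟨u, hu, rfl⟩, ⟨v, hv, rfl⟩⟩
    change toMHat u * toMHat v = toMHat v * toMHat u
    rw [← commutatorElement_eq_one_iff_mul_comm, ← map_commutatorElement]
    apply toMHat_eq_one_of_mem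
    rw [derivedSeries_succ, derivedSeries_one]
    exact Subgroup.commutator_mem_commutator hu hv
  exact key a (NHat_le_topologicalClosure ha) b (NHat_le_topologicalClosure hb)

/-- The continuous extension to `MHat` of a homomorphism from the free group to a metabelian
profinite group. -/
noncomputable def liftMHat {P : ProfiniteGrp.{0}} (f : F →* P) (hf : derivedSeries F 2 ≤ f.ker) :
    MHat →ₜ* P :=
  (ProfiniteCompletion.lift (GrpCat.ofHom (QuotientGroup.lift (derivedSeries F 2) f hf) :
      GrpCat.of M ⟶ GrpCat.of P)).hom

theorem liftMHat_toMHat {P : ProfiniteGrp.{0}} (f : F →* P) (hf : derivedSeries F 2 ≤ f.ker)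
    (w : F) : liftMHat f hf (toMHat w) = f w :=
  ConcreteCategory.congr_hom (ProfiniteCompletion.lift_eta
    (GrpCat.ofHom (QuotientGroup.lift (derivedSeries F 2) f hf) :
      GrpCat.of M ⟶ GrpCat.of P)) (QuotientGroup.mk w)

theorem hom_ext_MHat {P : Type*} [Group P] [TopologicalSpace P] [T2Space P] {f g : MHat →* P}
    (hf : Continuous f) (hg : Continuous g) (h : ∀ i, f (gen i) = g (gen i)) : f = g := by
  have h1 : f.comp toMHat = g.comp toMHat := FreeGroup.ext_hom _ _ h
  refine DFunLike.coe_injective (denseRange_toMHat.equalizer hf hg ?_)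
  funext w
  exact DFunLike.congr_fun h1 w

theorem derivedSeries_two_le_ker_of_commute {P : Type*} [Group P] (A : Subgroup P)
    (hA : ∀ x y : P, ⁅x, y⁆ ∈ A) (hcomm : ∀ x ∈ A, ∀ y ∈ A, x * y = y * x) (f : F →* P) :
    derivedSeries F 2 ≤ f.ker := by
  have h1 : (commutator F).map f ≤ A := by
    rw [commutator_def, Subgroup.map_commutator, Subgroup.commutator_le]
    exact fun a _ b _ => hA a b
  rw [derivedSeries_succ, derivedSeries_one, Subgroup.commutator_le]
  intro u hu v hv
  rw [MonoidHom.mem_ker, map_commutatorElement, commutatorElement_eq_one_iff_mul_comm]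
  exact hcomm _ (h1 ⟨u, hu, rfl⟩) _ (h1 ⟨v, hv, rfl⟩)

theorem derivedSeries_two_le_ker_MHat (f : F →* MHat) : derivedSeries F 2 ≤ f.ker :=
  derivedSeries_two_le_ker_of_commute NHat commutatorElement_mem_NHat
    (fun _ hx _ hy => setLike_mul_comm hx hy) f

/-- The continuous endomorphism of `MHat` with prescribed values on the generators. -/
noncomputable def endoMHat (p : Fin 2 → MHat) : MHat →ₜ* MHat :=
  liftMHat (FreeGroup.lift p) (derivedSeries_two_le_ker_MHat _)

theorem endoMHat_gen (p : Fin 2 → MHat) (i : Fin 2) : endoMHat p (gen i) = p i := by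
  rw [endoMHat, gen, liftMHat_toMHat, FreeGroup.lift_apply_of]

theorem continuous_endoMHat_apply (p : Fin 2 → MHat) : Continuous (endoMHat p) :=
  (endoMHat p).continuous_toFun

theorem eq_endoMHat {f : MHat →* MHat} (hf : Continuous f) (g : MHat) :
    endoMHat (fun i => f (gen i)) g = f g := by
  refine DFunLike.congr_fun (hom_ext_MHat (f := (endoMHat fun i => f (gen i)).toMonoidHom)
    (g := f) (continuous_endoMHat_apply _) hf fun i => ?_) g
  exact endoMHat_gen _ i

theorem exists_openNormalSubgroup_subset {O : Set MHat} (hO : IsOpen O) {a : MHat} (ha : a ∈ O) :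
    ∃ U : OpenNormalSubgroup MHat, ∀ g, a⁻¹ * g ∈ U.toSubgroup → g ∈ O := by
  obtain ⟨U, hU⟩ := exist_openNormalSubgroup_sub_open_nhds_of_one
    (hO.preimage (continuous_const_mul a)) (show a * 1 ∈ O by rwa [mul_one])
  refine ⟨U, fun g hg => ?_⟩
  have h : a * (a⁻¹ * g) ∈ O := hU hg
  rwa [mul_inv_cancel_left] at h

/-- Modulo U both maps are continuous into a discrete group, hence determined on the generators. The
resulting uniformity in m yields the joint continuity of `endoMHat`. -/
theorem inv_mul_mem_of_gen {U : OpenNormalSubgroup MHat} {f g : MHat →* MHat} (hf : Continuous f)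
    (hg : Continuous g) (h : ∀ i, (f (gen i))⁻¹ * g (gen i) ∈ U.toSubgroup) (m : MHat) :
    (f m)⁻¹ * g m ∈ U.toSubgroup := by
  have : DiscreteTopology (MHat ⧸ U.toSubgroup) :=
    QuotientGroup.discreteTopology U.isOpen'
  have := hom_ext_MHat (f := (QuotientGroup.mk' U.toSubgroup).comp f)
    (g := (QuotientGroup.mk' U.toSubgroup).comp g)
    (QuotientGroup.continuous_mk.comp hf) (QuotientGroup.continuous_mk.comp hg)
    fun i => QuotientGroup.eq.mpr (h i)
  exact QuotientGroup.eq.mp (DFunLike.congr_fun this m)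

theorem continuous_endoMHat : Continuous fun q : (Fin 2 → MHat) × MHat => endoMHat q.1 q.2 := by
  rw [continuous_iff_continuousAt]
  rintro ⟨p, m⟩
  rw [ContinuousAt, tendsto_nhds]
  intro O hO hm
  obtain ⟨U, hU⟩ := exists_openNormalSubgroup_subset hO hm
  have h1 : IsOpen ({q | ∀ i, (p i)⁻¹ * q.1 i ∈ U.toSubgroup} ∩
      {q | (endoMHat p m)⁻¹ * endoMHat p q.2 ∈ U.toSubgroup} :
        Set ((Fin 2 → MHat) × MHat)) := by
    refine IsOpen.inter ?_ (U.isOpen'.preimage (f := fun q : (Fin 2 → MHat) × MHat =>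
      (endoMHat p m)⁻¹ * endoMHat p q.2)
      (continuous_const.mul ((continuous_endoMHat_apply p).comp continuous_snd)))
    rw [Set.ofPred_forall]
    refine isOpen_iInter_of_finite fun i => U.isOpen'.preimage
      (f := fun q : (Fin 2 → MHat) × MHat => (p i)⁻¹ * q.1 i) (by fun_prop)
  refine Filter.mem_of_superset (h1.mem_nhds ⟨fun i => ?_, ?_⟩) ?_
  · change (p i)⁻¹ * p i ∈ U.toSubgroup
    rw [inv_mul_cancel]
    exact one_mem _
  · change (endoMHat p m)⁻¹ * endoMHat p m ∈ U.toSubgroup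
    rw [inv_mul_cancel]
    exact one_mem _
  · rintro ⟨p', m'⟩ ⟨h2, h3⟩
    apply hU
    have h4 := inv_mul_mem_of_gen (U := U) (f := (endoMHat p).toMonoidHom)
      (g := (endoMHat p').toMonoidHom) (continuous_endoMHat_apply p) (continuous_endoMHat_apply p')
      (fun i => by
        change (endoMHat p (gen i))⁻¹ * endoMHat p' (gen i) ∈ U.toSubgroup
        rw [endoMHat_gen, endoMHat_gen]
        exact h2 i) m'
    have h5 : (endoMHat p m)⁻¹ * endoMHat p m' * ((endoMHat p m')⁻¹ * endoMHat p' m') ∈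
        U.toSubgroup := mul_mem h3 h4
    rwa [mul_assoc, mul_inv_cancel_left] at h5

/-! ### The topological group of automorphisms of `MHat` -/

/-- The continuous map underlying a continuous automorphism. -/
def toContinuousMap {G : Type} [Group G] [TopologicalSpace G] (f : contAut G) : C(G, G) :=
  ⟨f.1, f.2.1⟩

theorem continuous_toContinuousMap {G : Type} [Group G] [TopologicalSpace G] :
    Continuous (toContinuousMap (G := G)) := continuous_induced_dom

theorem toContinuousMap_injective {G : Type} [Group G] [TopologicalSpace G] :
    Function.Injective (toContinuousMap (G := G)) := by
  intro f g h
  apply Subtype.ext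
  ext x
  exact DFunLike.congr_fun h x

theorem continuous_eval_contAut {G : Type} [Group G] [TopologicalSpace G] (x : G) :
    Continuous fun f : contAut G => f.1 x :=
  (continuous_eval_const (F := C(G, G)) x).comp continuous_toContinuousMap

instance {G : Type} [Group G] [TopologicalSpace G] [T2Space G] : T2Space (contAut G) :=
  T2Space.of_injective_continuous toContinuousMap_injective continuous_toContinuousMap

theorem contAut_ext {f g : contAut MHat} (h : ∀ i, f.1 (gen i) = g.1 (gen i)) : f = g := by
  have := hom_ext_MHat (f := f.1.toMonoidHom) (g := g.1.toMonoidHom) f.2.1 g.2.1 h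
  apply Subtype.ext
  ext x
  exact DFunLike.congr_fun this x

/-- `endoMHat p` as a continuous map. -/
noncomputable def endoMap (p : Fin 2 → MHat) : C(MHat, MHat) :=
  ⟨endoMHat p, continuous_endoMHat_apply p⟩

theorem continuous_endoMap : Continuous endoMap :=
  ContinuousMap.continuous_of_continuous_uncurry _ continuous_endoMHat

/-- The pairs of mutually inverse endomorphisms of `MHat`. -/
def inversePairs : Set ((Fin 2 → MHat) × (Fin 2 → MHat)) :=
  {q | (endoMap q.1).comp (endoMap q.2) = ContinuousMap.id _ ∧
    (endoMap q.2).comp (endoMap q.1) = ContinuousMap.id _}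

theorem isClosed_inversePairs : IsClosed inversePairs := by
  refine IsClosed.inter (isClosed_eq ?_ continuous_const) (isClosed_eq ?_ continuous_const)
  · exact (continuous_endoMap.comp continuous_fst).compCM (continuous_endoMap.comp continuous_snd)
  · exact (continuous_endoMap.comp continuous_snd).compCM (continuous_endoMap.comp continuous_fst)

instance : CompactSpace inversePairs :=
  isCompact_iff_compactSpace.mp isClosed_inversePairs.isCompact

/-- The automorphism of `MHat` given by a pair of mutually inverse endomorphisms. -/
noncomputable def ofInversePair (q : inversePairs) : contAut MHat :=
  ⟨{ toFun := endoMHat q.1.1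
     invFun := endoMHat q.1.2
     left_inv := DFunLike.congr_fun q.2.2
     right_inv := DFunLike.congr_fun q.2.1
     map_mul' := map_mul _ }, continuous_endoMHat_apply _, continuous_endoMHat_apply _⟩

theorem continuous_ofInversePair : Continuous ofInversePair :=
  continuous_induced_rng.mpr (continuous_endoMap.comp (continuous_fst.comp continuous_subtype_val))

theorem continuous_ofInversePair_inv : Continuous fun q => (ofInversePair q)⁻¹ :=
  continuous_induced_rng.mpr (continuous_endoMap.comp (continuous_snd.comp continuous_subtype_val))

theorem ofInversePair_surjective : Function.Surjective ofInversePair := by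
  intro f
  have h1 : ∀ g, endoMHat (fun i => f.1 (gen i)) g = f.1 g :=
    eq_endoMHat (f := f.1.toMonoidHom) f.2.1
  have h2 : ∀ g, endoMHat (fun i => f.1.symm (gen i)) g = f.1.symm g :=
    eq_endoMHat (f := f.1.symm.toMonoidHom) f.2.2
  refine ⟨⟨(fun i => f.1 (gen i), fun i => f.1.symm (gen i)), ?_, ?_⟩, ?_⟩
  · ext g
    change endoMHat _ (endoMHat _ g) = g
    rw [h1, h2, MulEquiv.apply_symm_apply]
  · ext g
    change endoMHat _ (endoMHat _ g) = g
    rw [h1, h2, MulEquiv.symm_apply_apply]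
  · apply Subtype.ext
    ext g
    exact h1 g

/-- Bijectivity alone is not visibly a closed condition on the images of the generators. Recording
the inverse as well makes it one, and Aut is then an image of a closed subset of a compact space. -/
instance : CompactSpace (contAut MHat) :=
  ofInversePair_surjective.compactSpace continuous_ofInversePair

instance : IsTopologicalGroup (contAut MHat) where
  continuous_mul := continuous_induced_rng.mpr
    ((continuous_toContinuousMap.comp continuous_fst).compCM
      (continuous_toContinuousMap.comp continuous_snd))
  continuous_inv := by
    -- On pairs of mutually inverse endomorphisms, inversion is the interchange of the two entries.
    rw [(Topology.IsQuotientMap.of_surjective_continuous ofInversePair_surjective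
      continuous_ofInversePair).continuous_iff]
    exact continuous_ofInversePair_inv

/-- Conjugation as a homomorphism from `MHat` to its group of continuous automorphisms. -/
noncomputable def conjMHat : MHat →* contAut MHat :=
  (MulAut.conj : MHat →* MulAut MHat).codRestrict (contAut MHat) fun g =>
    ⟨by change Continuous fun x => g * x * g⁻¹; fun_prop,
      by change Continuous fun x => g⁻¹ * x * g; fun_prop⟩

theorem conjMHat_apply (g x : MHat) : (conjMHat g).1 x = g * x * g⁻¹ := rfl

theorem mem_innAut_iff {f : contAut MHat} : f ∈ innAut MHat ↔ ∃ g, conjMHat g = f := by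
  refine ⟨fun ⟨g, hg⟩ => ⟨g, Subtype.ext hg⟩, ?_⟩
  rintro ⟨g, rfl⟩
  exact ⟨g, rfl⟩

theorem continuous_conjMHat : Continuous conjMHat := by
  refine continuous_induced_rng.mpr (ContinuousMap.continuous_of_continuous_uncurry _ ?_)
  change Continuous fun q : MHat × MHat => q.1 * q.2 * q.1⁻¹
  fun_prop

/-- Makes Out(`MHat`) Hausdorff, which the uniqueness of ρ by density requires. -/
instance isClosed_innAut : IsClosed (innAut MHat : Set (contAut MHat)) := by
  have : (innAut MHat : Set (contAut MHat)) = Set.range conjMHat := by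
    ext f
    exact mem_innAut_iff
  rw [this]
  exact (isCompact_range continuous_conjMHat).isClosed

end MHat

/-! ### Automorphisms of `MHat` fixing `[x₁, x₂]` and acting trivially on the abelianization -/

section Inner

open Polynomial
open scoped IsMulCommutative commutatorElement

instance isMulCommutative_commutator_M : IsMulCommutative (commutator M) := by
  have h : derivedSeries M 2 = ⊥ := by
    rw [← map_derivedSeries_eq (QuotientGroup.mk'_surjective (derivedSeries F 2)),
      QuotientGroup.map_mk'_self]
  refine IsMulCommutative.of_setLike_mul_comm fun a ha b hb => ?_
  have h1 : ⁅a, b⁆ ∈ derivedSeries M 2 := by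
    rw [derivedSeries_succ M 1, derivedSeries_one]
    exact Subgroup.commutator_mem_commutator ha hb
  rwa [h, Subgroup.mem_bot, commutatorElement_eq_one_iff_mul_comm] at h1

/-- The generators of `M`. -/
def genM (i : Fin 2) : M := QuotientGroup.mk (FreeGroup.of i)

theorem closure_genM : Subgroup.closure {genM 0, genM 1} = ⊤ := by
  have h1 := congrArg (Subgroup.map (QuotientGroup.mk' (derivedSeries F 2)))
    (FreeGroup.closure_range_of (Fin 2))
  rw [MonoidHom.map_closure, Subgroup.map_top_of_surjective _ (QuotientGroup.mk'_surjective _),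
    ← Set.range_comp] at h1
  rw [← h1]
  congr 1
  ext x
  simp only [Set.mem_insert_iff, Set.mem_singleton_iff, Set.mem_range, Fin.exists_fin_two]
  exact or_congr eq_comm eq_comm

/-- The canonical map from `M` to its profinite completion. -/
def etaM : M →* MHat := (ProfiniteCompletion.eta (GrpCat.of M)).hom

theorem etaM_mem_NHat {m : M} (hm : m ∈ commutator M) : etaM m ∈ NHat := by
  have h : commutator M ≤ NHat.comap etaM := by
    rw [commutator_def, Subgroup.commutator_le]
    intro a _ b _
    rw [Subgroup.mem_comap, map_commutatorElement]
    exact commutatorElement_mem_NHat _ _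
  exact h hm

/-- The homomorphism between the derived subgroups of `M` and `MHat`. -/
noncomputable def etaN : Additive (commutator M) →+ Additive NHat :=
  mapSubgroup (commutator M) NHat etaM fun _ => etaM_mem_NHat

/-- The action of `ℤ[b][a]` on the closed commutator subgroup of `MHat`. -/
noncomputable abbrev actHat : BiPoly →+* AddMonoid.End (Additive NHat) :=
  polyAct NHat (commutatorElement_mem_NHat (gen 0) (gen 1))

/-- The commutator of the generators of `MHat`. -/
noncomputable abbrev cHat : Additive NHat :=
  commElt NHat (commutatorElement_mem_NHat (gen 0) (gen 1))

theorem etaN_polyAct (p : BiPoly) (m : Additive (commutator M)) :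
    etaN (polyAct (commutator M) (commutatorElement_mem_commutator (genM 0) (genM 1)) p m) =
      actHat p (etaN m) := by
  have key : ∀ i, etaM (genM i) * (gen i)⁻¹ ∈ NHat := fun i => by
    rw [show etaM (genM i) = gen i from rfl, mul_inv_cancel]
    exact one_mem _
  exact mapSubgroup_polyAct (commutator M) NHat _ _ etaM _ (key 0) (key 1) p m

/-- The intersection of an open normal subgroup with `NHat`, written additively. -/
noncomputable def interNHat (U : OpenNormalSubgroup MHat) : AddSubgroup (Additive NHat) :=
  (U.toSubgroup.subgroupOf NHat).toAddSubgroup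

theorem mem_interNHat {U : OpenNormalSubgroup MHat} {m : Additive NHat} :
    m ∈ interNHat U ↔ (m.toMul : MHat) ∈ U.toSubgroup := Iff.rfl

theorem actHat_mem_interNHat {U : OpenNormalSubgroup MHat} (p : BiPoly) {m : Additive NHat}
    (hm : m ∈ interNHat U) : actHat p m ∈ interNHat U :=
  polyAct_mem NHat _ (fun _ hm => U.isNormal'.conj_mem _ hm _)
    (fun _ hm => U.isNormal'.conj_mem _ hm _) p hm

theorem conjEnd_sub_mem_interNHat {U : OpenNormalSubgroup MHat} {u : MHat} (hu : u ∈ U.toSubgroup)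
    (m : Additive NHat) : conjEnd NHat u m - m ∈ interNHat U := by
  rw [mem_interNHat, sub_eq_add_neg, coe_toMul_add]
  change u * (m.toMul : MHat) * u⁻¹ * (m.toMul : MHat)⁻¹ ∈ U.toSubgroup
  rw [mul_assoc, mul_assoc, ← mul_assoc (m.toMul : MHat)]
  exact mul_mem hu (U.isNormal'.conj_mem _ (inv_mem hu) _)

theorem index_ne_zero (U : OpenNormalSubgroup MHat) : U.toSubgroup.index ≠ 0 := by
  have : Finite (MHat ⧸ U.toSubgroup) := Subgroup.quotient_finite_of_isOpen _ U.isOpen'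
  exact Subgroup.index_ne_zero_of_finite

/-- Modulo every open normal subgroup, `NHat` is generated by `[x₁, x₂]` under the action of
polynomials. -/
theorem exists_actHat_sub_mem (U : OpenNormalSubgroup MHat) (m : Additive NHat) :
    ∃ f : BiPoly, m - actHat f cHat ∈ interNHat U := by
  have h1 : (m.toMul : MHat) ∈ closure (((commutator F).map toMHat : Subgroup MHat) : Set MHat) :=
    NHat_le_topologicalClosure m.toMul.2
  obtain ⟨_, hU, w, hw, rfl⟩ := mem_closure_iff.mp h1
    {g | (m.toMul : MHat) * g⁻¹ ∈ U.toSubgroup}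
    (U.isOpen'.preimage (f := fun g => (m.toMul : MHat) * g⁻¹) (by fun_prop))
    (by
      change (m.toMul : MHat) * (m.toMul : MHat)⁻¹ ∈ U.toSubgroup
      rw [mul_inv_cancel]
      exact one_mem _)
  have hw' : (QuotientGroup.mk w : M) ∈ commutator M := by
    have h : (commutator F).map (QuotientGroup.mk' (derivedSeries F 2)) ≤ commutator M := by
      rw [commutator_def, Subgroup.map_commutator]
      exact Subgroup.commutator_mono le_top le_top
    exact h ⟨w, hw, rfl⟩
  let v : Additive (commutator M) := Additive.ofMul ⟨_, hw'⟩
  obtain ⟨i, j, f, hf⟩ := exists_polyAct_commElt (commutator M)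
    (commutatorElement_mem_commutator (genM 0) (genM 1)) closure_genM (m := v) hw'
  have hf' := congrArg etaN hf
  rw [etaN_polyAct, etaN_polyAct] at hf'
  change _ = actHat f cHat at hf'
  -- With index k + 1, the monomial (a^i b^j)^k inverts a^i b^j modulo U, because g^{k+1} ∈ U for
  -- every g. So no denominators are left.
  obtain ⟨k, hk⟩ := Nat.exists_eq_succ_of_ne_zero (index_ne_zero U)
  refine ⟨X ^ (i * k) * C X ^ (j * k) * f, ?_⟩
  rw [polyAct_mul_apply, ← hf', ← polyAct_mul_apply,
    show (X ^ (i * k) * C X ^ (j * k) * (X ^ i * C X ^ j) : BiPoly) =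
      X ^ (i * U.toSubgroup.index) * C X ^ (j * U.toSubgroup.index) by
      rw [hk, Nat.succ_eq_add_one]; ring,
    polyAct_monomial]
  have hpow : ∀ (g : MHat) (l : ℕ), g ^ (l * U.toSubgroup.index) ∈ U.toSubgroup := by
    intro g l
    rw [mul_comm, pow_mul]
    exact pow_mem (U.toSubgroup.pow_index_mem g) l
  have h2 := conjEnd_sub_mem_interNHat (mul_mem (hpow (gen 0) i) (hpow (gen 1) j)) (etaN v)
  have h3 : m - etaN v ∈ interNHat U := by
    rw [sub_eq_add_neg]
    exact hU
  have h4 := sub_mem h3 h2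
  rwa [sub_sub_sub_cancel_right] at h4

/-- With d the index of U, every d-th power lies in U. Hence d kills `NHat` modulo U, and a^d and
b^d act as the identity modulo U. -/
theorem actHat_mem_interNHat_of_mem_levelIdeal (U : OpenNormalSubgroup MHat) {f : BiPoly}
    (hf : f ∈ levelIdeal U.toSubgroup.index U.toSubgroup.index) (m : Additive NHat) :
    actHat f m ∈ interNHat U := by
  obtain ⟨p, q, r, rfl⟩ := mem_levelIdeal.mp hf
  rw [polyAct_add_apply, polyAct_add_apply]
  refine add_mem (add_mem ?_ ?_) ?_
  · rw [polyAct_mul_apply, map_natCast]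
    change ((actHat p m).toMul : MHat) ^ _ ∈ U.toSubgroup
    exact U.toSubgroup.pow_index_mem _
  · rw [polyAct_mul_apply, polyAct_sub_apply, map_pow, polyAct_X, map_one, ← conjEnd_pow]
    exact conjEnd_sub_mem_interNHat (U.toSubgroup.pow_index_mem _) _
  · rw [polyAct_mul_apply, polyAct_sub_apply, map_pow, polyAct_C_X, map_one, ← conjEnd_pow]
    exact conjEnd_sub_mem_interNHat (U.toSubgroup.pow_index_mem _) _

theorem biEval_eq_ringHom {S : Type*} [CommRing S] (π : BiPoly →+* S) :
    biEval (π X) (π (C X)) (Commute.all (π X) (π (C X))) = π := by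
  have h := Commute.all (π X) (π (C X))
  have h1 : (biEval (π X) (π (C X)) h).comp C = π.comp C :=
    Polynomial.ringHom_ext (fun c => by simp) (biEval_C_X h)
  exact Polynomial.ringHom_ext (DFunLike.congr_fun h1) (biEval_X h)

theorem derivedSeries_two_le_ker_Aff {S : Type*} [CommRing S] (f : F →* Aff S) :
    derivedSeries F 2 ≤ f.ker :=
  derivedSeries_two_le_ker_of_commute Aff.linear.ker
    (fun x y => by
      rw [MonoidHom.mem_ker, map_commutatorElement, commutatorElement_eq_one_iff_mul_comm]
      exact mul_comm _ _) Aff.isMulCommutative_ker_linear f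

/-- The annihilator of `[x₁, x₂]` in suitable finite quotients of `MHat`. -/
theorem exists_ringHom_eq_zero {S : Type} [CommRing S] [Finite S] (π : BiPoly →+* S) (a b : Sˣ)
    (ha : a = π X) (hb : b = π (C X)) :
    ∃ V : OpenNormalSubgroup MHat, ∀ f : BiPoly, actHat f cHat ∈ interNHat V →
      π ((X - 1) * f) = 0 := by
  let P : ProfiniteGrp.{0} := ofFiniteGrp (FiniteGrp.of (Aff S))
  let μ₀ : F →* Aff S := FreeGroup.lift ![⟨a, 0⟩, ⟨b, 1⟩]
  let μ : MHat →ₜ* P := liftMHat (P := P) μ₀ (derivedSeries_two_le_ker_Aff μ₀)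
  let μ' : MHat →* Aff S := μ.toMonoidHom
  have hP : DiscreteTopology P := ⟨rfl⟩
  have hV : IsOpen (μ'.ker : Set MHat) :=
    (isOpen_discrete ({1} : Set P)).preimage μ.continuous_toFun
  refine ⟨⟨⟨μ'.ker, hV⟩, MonoidHom.normal_ker _⟩, fun f hf => ?_⟩
  have hN : ∀ m ∈ NHat, (μ' m).u = 1 := by
    have h1 : (commutator F).map toMHat ≤ (Aff.linear.comp μ').ker := by
      rw [commutator_def, Subgroup.map_commutator, Subgroup.commutator_le]
      intro x _ y _
      rw [MonoidHom.mem_ker, map_commutatorElement, commutatorElement_eq_one_iff_mul_comm]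
      exact mul_comm (Aff.linear (μ' x)) (Aff.linear (μ' y))
    have h2 : IsClosed ((Aff.linear.comp μ').ker : Set MHat) :=
      (isClosed_discrete (α := P) {x : Aff S | x.u = 1}).preimage μ.continuous_toFun
    exact fun m hm => Subgroup.topologicalClosure_minimal _ h1 h2 (NHat_le_topologicalClosure hm)
  have h₀ : μ' (gen 0) = ⟨a, 0⟩ :=
    (liftMHat_toMHat (P := P) μ₀ _ _).trans (FreeGroup.lift_apply_of ..)
  have h₁ : μ' (gen 1) = ⟨b, 1⟩ :=
    (liftMHat_toMHat (P := P) μ₀ _ _).trans (FreeGroup.lift_apply_of ..)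
  have h2 := aff_polyAct_commElt NHat (commutatorElement_mem_NHat (gen 0) (gen 1)) μ' hN a b h₀ h₁ f
  have h3 : μ' (actHat f cHat).toMul = 1 := hf
  rw [h3, Aff.one_t] at h2
  simp only [ha, hb, biEval_eq_ringHom π] at h2
  rw [mul_comm]
  exact h2.symm

/-- The quotient by the level ideal is finite and a, b are units in it because a^k = b^k = 1, so V
can be the kernel of the affine representation over it. The factor X - 1 is the translation attached
to c and is cancelled afterwards by lowering the level. -/
theorem exists_mul_mem_levelIdeal {n k : ℕ} (hn : n ≠ 0) (hk : k ≠ 0) :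
    ∃ V : OpenNormalSubgroup MHat, ∀ f : BiPoly, actHat f cHat ∈ interNHat V →
      (X - 1) * f ∈ levelIdeal n k := by
  let π := Ideal.Quotient.mk (levelIdeal n k)
  have hpow : ∀ t : BiPoly, t ^ k - 1 ∈ levelIdeal n k → π t ^ k = 1 := by
    intro t ht
    rw [← Ideal.Quotient.eq_zero_iff_mem, map_sub, map_pow, map_one] at ht
    exact sub_eq_zero.mp ht
  have ha := hpow _ (X_pow_sub_one_mem_levelIdeal n k)
  have hb := hpow _ (C_X_pow_sub_one_mem_levelIdeal n k)
  have hfin : Finite (BiPoly ⧸ levelIdeal n k) := by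
    refine finite_of_surjective_biPoly π Ideal.Quotient.mk_surjective hn hk ?_ ha hb
    have := Ideal.Quotient.eq_zero_iff_mem.mpr (natCast_mem_levelIdeal n k)
    rwa [map_natCast] at this
  obtain ⟨V, hV⟩ := exists_ringHom_eq_zero (S := BiPoly ⧸ levelIdeal n k) π
    (Units.ofPowEqOne _ k ha hk) (Units.ofPowEqOne _ k hb hk) rfl rfl
  exact ⟨V, fun f hf => Ideal.Quotient.eq_zero_iff_mem.mp (hV f hf)⟩

/-- Here n i, defined by θ(gᵢ) = nᵢgᵢ, is a cocycle, and the relation coming from c makes it a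
coboundary modulo U by Koszul exactness. -/
theorem exists_conj_mod_openNormalSubgroup (θ : contAut MHat)
    (hab : ∀ i, θ.1 (gen i) * (gen i)⁻¹ ∈ NHat) (hc : θ.1 ⁅gen 0, gen 1⁆ = ⁅gen 0, gen 1⁆)
    (U : OpenNormalSubgroup MHat) :
    ∃ m : MHat, ∀ i, (m * gen i * m⁻¹)⁻¹ * θ.1 (gen i) ∈ U.toSubgroup := by
  let n : Fin 2 → Additive NHat := fun i => Additive.ofMul ⟨_, hab i⟩
  have hrel : actHat (X - 1) (n 1) = actHat (C X - 1) (n 0) := by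
    have h1 := commutatorElement_mul_mul NHat (commutatorElement_mem_NHat (gen 0) (gen 1))
      (n 0) (n 1)
    change ⁅θ.1 (gen 0) * (gen 0)⁻¹ * gen 0, θ.1 (gen 1) * (gen 1)⁻¹ * gen 1⁆ = _ at h1
    rw [inv_mul_cancel_right, inv_mul_cancel_right, ← map_commutatorElement, hc] at h1
    have h2 := coe_toMul_injective NHat (a₁ := cHat) h1
    rw [add_sub_assoc, left_eq_add, sub_eq_zero] at h2
    exact h2
  set d := U.toSubgroup.index
  have hd : d ≠ 0 := index_ne_zero U
  -- Start at level d⁴: cancelling X - 1 leaves d³, and the Koszul lift uses up two more factors,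
  -- ending at level d, where `actHat_mem_interNHat_of_mem_levelIdeal` applies.
  obtain ⟨V, hV⟩ := exists_mul_mem_levelIdeal (n := d) (k := d * (d * (d * d))) hd (by positivity)
  obtain ⟨W, hW⟩ := exists_openNormalSubgroup_subset (U.isOpen'.inter V.isOpen')
    (show (1 : MHat) ∈ _ from ⟨one_mem U.toSubgroup, one_mem V.toSubgroup⟩)
  simp only [inv_one, one_mul] at hW
  choose f hf using fun i => exists_actHat_sub_mem W (n i)
  have hmem : actHat ((X - 1) * f 1 - (C X - 1) * f 0) cHat ∈ interNHat V := by
    refine (hW _ (?_ : _ ∈ interNHat W)).2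
    have h1 := sub_mem (actHat_mem_interNHat (C X - 1) (hf 0)) (actHat_mem_interNHat (X - 1) (hf 1))
    rw [map_sub (actHat (C X - 1)), map_sub (actHat (X - 1)), hrel, sub_sub_sub_cancel_left] at h1
    rwa [polyAct_sub_apply, polyAct_mul_apply, polyAct_mul_apply]
  obtain ⟨u, hu₀, hu₁⟩ := exists_koszul_lift hd hd
    (mem_levelIdeal_of_X_sub_one_mul_mem hd (by positivity) (hV _ hmem))
  have key : ∀ i p, f i - p * u ∈ levelIdeal d d →
      n i - actHat p (actHat u cHat) ∈ interNHat U := by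
    intro i p hp
    have h1 := actHat_mem_interNHat_of_mem_levelIdeal U hp cHat
    have h2 : n i - actHat (f i) cHat ∈ interNHat U := (hW _ (hf i)).1
    have h3 := add_mem h2 h1
    rwa [polyAct_sub_apply, polyAct_mul_apply, sub_add_sub_cancel] at h3
  have key₂ : ∀ i, n i - (conjEnd NHat (gen i) (actHat u cHat) - actHat u cHat) ∈ interNHat U := by
    refine Fin.forall_fin_two.mpr ⟨?_, ?_⟩
    · have h1 := key 0 _ hu₀
      rwa [polyAct_sub_apply, polyAct_X, map_one] at h1
    · have h1 := key 1 _ hu₁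
      rwa [polyAct_sub_apply, polyAct_C_X, map_one] at h1
  -- Conjugation by m sends gᵢ to (m - gᵢ·m)gᵢ, so m = -uc gives the cocycle (gᵢ - 1)uc.
  refine ⟨((-actHat u cHat).toMul : MHat), fun i => ?_⟩
  have h1 := key₂ i
  rw [show n i - (conjEnd NHat (gen i) (actHat u cHat) - actHat u cHat) =
    conjEnd NHat (gen i) (-actHat u cHat) - -actHat u cHat + n i by rw [map_neg]; abel] at h1
  generalize -actHat u cHat = m at h1 ⊢
  have h2 : gen i * (m.toMul : MHat) * (gen i)⁻¹ * (m.toMul : MHat)⁻¹ *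
      (θ.1 (gen i) * (gen i)⁻¹) ∈ U.toSubgroup := by
    rw [sub_eq_add_neg] at h1
    exact h1
  have h3 := U.isNormal'.conj_mem _ h2 (gen i)⁻¹
  convert h3 using 1
  group

/-- An automorphism of `MHat` that fixes `[x₁, x₂]` and acts trivially on the abelianization is
inner. -/
theorem mem_innAut_of_fixes_commutator (θ : contAut MHat)
    (hab : ∀ i, θ.1 (gen i) * (gen i)⁻¹ ∈ NHat) (hc : θ.1 ⁅gen 0, gen 1⁆ = ⁅gen 0, gen 1⁆) :
    θ ∈ innAut MHat := by
  -- The simultaneous conjugates of the generators form a compact set, so solutions modulo every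
  -- open normal subgroup give an exact one.
  have hcl : IsClosed (Set.range fun (m : MHat) (i : Fin 2) => m * gen i * m⁻¹) :=
    (isCompact_range (by fun_prop)).isClosed
  have hmem : (fun i => θ.1 (gen i)) ∈ Set.range fun (m : MHat) (i : Fin 2) => m * gen i * m⁻¹ := by
    rw [← hcl.closure_eq, mem_closure_iff]
    intro O hO hθ
    obtain ⟨s, hs, hsO⟩ := isOpen_pi_iff'.mp hO _ hθ
    choose U hU using fun i => exists_openNormalSubgroup_subset (hs i).1 (hs i).2
    obtain ⟨W, hW⟩ := exists_openNormalSubgroup_subset ((U 0).isOpen'.inter (U 1).isOpen')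
      (show (1 : MHat) ∈ _ from ⟨one_mem (U 0).toSubgroup, one_mem (U 1).toSubgroup⟩)
    simp only [inv_one, one_mul] at hW
    obtain ⟨m, hm⟩ := exists_conj_mod_openNormalSubgroup θ hab hc W
    refine ⟨_, hsO fun i _ => hU i _ ?_, m, rfl⟩
    have h1 : ∀ g ∈ W.toSubgroup, ∀ i, g ∈ (U i).toSubgroup := fun g hg =>
      Fin.forall_fin_two.mpr (hW g hg)
    have h2 := inv_mem (h1 _ (hm i) i)
    rwa [mul_inv_rev, inv_inv] at h2
  obtain ⟨m, hm⟩ := hmem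
  exact mem_innAut_iff.mpr ⟨m, contAut_ext fun i => congrFun hm i⟩

end Inner

/-! ### Density of `SL₂(ℤ)` in `SL₂(ZHat)` -/

section Density

/-- The residue of a profinite integer modulo `n`. -/
def residue (n : ℕ+) : ZHat →+* ZMod n :=
  (Pi.evalRingHom (fun n : ℕ+ => ZMod n) n).comp ZHat.subtype

theorem continuous_residue (n : ℕ+) : Continuous (residue n) :=
  (continuous_apply n).comp continuous_subtype_val

theorem ZHat_ext {x y : ZHat} (h : ∀ n, residue n x = residue n y) : x = y :=
  Subtype.ext (funext h)

/-- Take t to be the product of the primes dividing n but not a. For each prime p dividing n,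
exactly one of a and tc is divisible by p, so the sum is prime to n. -/
theorem exists_isUnit_add_mul {n : ℕ} [NeZero n] {a c : ZMod n} (h : IsCoprime a c) :
    ∃ t : ZMod n, IsUnit (a + t * c) := by
  let t : ℕ := ∏ p ∈ n.primeFactors with ¬p ∣ a.val, p
  refine ⟨t, ?_⟩
  have h1 : a + t * c = ((a.val + t * c.val : ℕ) : ZMod n) := by simp
  rw [h1, ZMod.isUnit_iff_coprime]
  refine Nat.coprime_of_dvd fun p hp hpa hpn => ?_
  have hdvd : ∀ x : ZMod n, p ∣ x.val → ZMod.castHom hpn (ZMod p) x = 0 := by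
    intro x hx
    rw [← ZMod.natCast_zmod_val x, map_natCast]
    exact (ZMod.natCast_eq_zero_iff _ _).mpr hx
  by_cases ha : p ∣ a.val
  · rcases hp.dvd_mul.mp ((Nat.dvd_add_right ha).mp hpa) with ht | hc
    · obtain ⟨q, hq, hpq⟩ := (Prime.dvd_finsetProd_iff hp.prime _).mp ht
      rw [Finset.mem_filter, Nat.mem_primeFactors] at hq
      rw [Nat.prime_dvd_prime_iff_eq hp hq.1.1] at hpq
      exact hq.2 (hpq ▸ ha)
    · obtain ⟨u, v, huv⟩ := h
      have h2 := congrArg (ZMod.castHom hpn (ZMod p)) huv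
      rw [map_add, map_mul, map_mul, hdvd a ha, hdvd c hc, mul_zero, mul_zero, add_zero,
        map_one] at h2
      have := Fact.mk hp
      exact zero_ne_one h2
  · have ht : p ∣ t := Finset.dvd_prod_of_mem (fun p => p)
      (Finset.mem_filter.mpr ⟨Nat.mem_primeFactors.mpr ⟨hp, hpn, NeZero.ne n⟩, ha⟩)
    exact ha ((Nat.dvd_add_left (ht.mul_right _)).mp hpa)

/-- The upper unitriangular matrix with entry `s`. -/
def upperUni {R : Type*} [CommRing R] (s : R) : SL(2, R) := ⟨!![1, s; 0, 1], by simp⟩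

/-- The lower unitriangular matrix with entry `s`. -/
def lowerUni {R : Type*} [CommRing R] (s : R) : SL(2, R) := ⟨!![1, 0; s, 1], by simp⟩

section Uni

variable {R : Type*} [CommRing R] (s : R) (g : SL(2, R)) (j : Fin 2)

theorem upperUni_mul_zero : (upperUni s * g).1 0 j = g.1 0 j + s * g.1 1 j := by
  rw [Matrix.SpecialLinearGroup.coe_mul, Matrix.mul_apply, Fin.sum_univ_two]
  simp [upperUni]

theorem upperUni_mul_one : (upperUni s * g).1 1 j = g.1 1 j := by
  rw [Matrix.SpecialLinearGroup.coe_mul, Matrix.mul_apply, Fin.sum_univ_two]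
  simp [upperUni]

theorem lowerUni_mul_zero : (lowerUni s * g).1 0 j = g.1 0 j := by
  rw [Matrix.SpecialLinearGroup.coe_mul, Matrix.mul_apply, Fin.sum_univ_two]
  simp [lowerUni]

theorem lowerUni_mul_one : (lowerUni s * g).1 1 j = s * g.1 0 j + g.1 1 j := by
  rw [Matrix.SpecialLinearGroup.coe_mul, Matrix.mul_apply, Fin.sum_univ_two]
  simp [lowerUni]

end Uni

theorem map_SL2Z_surjective (n : ℕ) [NeZero n] : Function.Surjective
    (Matrix.SpecialLinearGroup.map (n := Fin 2) (Int.castRingHom (ZMod n))) := by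
  rw [← MonoidHom.range_eq_top, Subgroup.eq_top_iff']
  intro g
  set R := (Matrix.SpecialLinearGroup.map (n := Fin 2) (Int.castRingHom (ZMod n))).range
  have hU : ∀ s : ZMod n, upperUni s ∈ R := by
    intro s
    obtain ⟨k, rfl⟩ := ZMod.intCast_surjective s
    refine ⟨upperUni k, ?_⟩
    ext i j
    change (((upperUni k).1 i j : ℤ) : ZMod n) = (upperUni (k : ZMod n)).1 i j
    fin_cases i <;> fin_cases j <;> simp [upperUni]
  have hL : ∀ s : ZMod n, lowerUni s ∈ R := by
    intro s
    obtain ⟨k, rfl⟩ := ZMod.intCast_surjective s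
    refine ⟨lowerUni k, ?_⟩
    ext i j
    change (((lowerUni k).1 i j : ℤ) : ZMod n) = (lowerUni (k : ZMod n)).1 i j
    fin_cases i <;> fin_cases j <;> simp [lowerUni]
  have hdet := g.det_coe
  rw [Matrix.det_fin_two] at hdet
  obtain ⟨t, u, hu⟩ := exists_isUnit_add_mul (a := g.1 0 0) (c := g.1 1 0)
    ⟨g.1 1 1, -g.1 0 1, by linear_combination hdet⟩
  let s : ZMod n := ↑u⁻¹ * (1 - g.1 1 0)
  have hs : u * s = 1 - g.1 1 0 := by simp [s]
  -- Row operations on the first column: its top entry becomes the unit u, its bottom entry then 1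
  -- by the choice of s, and finally the column becomes (1, 0).
  let x := lowerUni (-1) * (upperUni (1 - (u : ZMod n)) * (lowerUni s * (upperUni t * g)))
  have h00 : x.1 0 0 = 1 := by
    simp only [x, lowerUni_mul_zero, lowerUni_mul_one, upperUni_mul_zero, upperUni_mul_one, ← hu]
    linear_combination (1 - (u : ZMod n)) * hs
  have h10 : x.1 1 0 = 0 := by
    simp only [x, lowerUni_mul_zero, lowerUni_mul_one, upperUni_mul_zero, upperUni_mul_one, ← hu]
    linear_combination (u : ZMod n) * hs
  have hx : x = upperUni (x.1 0 1) := by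
    have hdet' := x.det_coe
    rw [Matrix.det_fin_two, h00, h10] at hdet'
    have h11 : x.1 1 1 = 1 := by linear_combination hdet'
    ext i j
    fin_cases i <;> fin_cases j <;> simp [upperUni, h00, h10, h11]
  have hxR : x ∈ R := hx ▸ hU _
  rwa [R.mul_mem_cancel_left (hL _), R.mul_mem_cancel_left (hU _), R.mul_mem_cancel_left (hL _),
    R.mul_mem_cancel_left (hU _)] at hxR

theorem denseRange_SL2Z : DenseRange
    (Matrix.SpecialLinearGroup.map (n := Fin 2) (Int.castRingHom ZHat)) := by
  intro x
  -- Matching x modulo m! gives convergence, since every n divides m! for m ≥ n.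
  let N : ℕ → ℕ+ := fun m => ⟨m.factorial, m.factorial_pos⟩
  choose γ hγ using fun m => map_SL2Z_surjective (N m)
    (Matrix.SpecialLinearGroup.map (n := Fin 2) (residue (N m)) x)
  refine mem_closure_of_tendsto (b := Filter.atTop)
    (f := fun m => Matrix.SpecialLinearGroup.map (n := Fin 2) (Int.castRingHom ZHat) (γ m)) ?_
    (Filter.Eventually.of_forall fun m => ⟨γ m, rfl⟩)
  refine Matrix.SpecialLinearGroup.isClosedEmbedding_val.isInducing.tendsto_nhds_iff.mpr
    (tendsto_pi_nhds.mpr fun i => tendsto_pi_nhds.mpr fun j => ?_)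
  rw [tendsto_subtype_rng, tendsto_pi_nhds]
  intro n
  apply tendsto_nhds_of_eventually_eq
  filter_upwards [Filter.eventually_ge_atTop (n : ℕ)] with m hm
  have hd : (n : ℕ) ∣ N m := Nat.dvd_factorial n.pos hm
  have h1 : ((γ m).1 i j : ZMod (N m)) = (x.1 i j).1 (N m) :=
    congrArg (fun g : SL(2, ZMod (N m)) => g.1 i j) (hγ m)
  have h2 := congrArg (ZMod.castHom hd (ZMod n)) h1
  rw [(x.1 i j).2 n (N m) hd, map_intCast] at h2
  exact h2

/-! ### The map from the completion of SL₂(ℤ) to SL₂(ZHat) and its kernel -/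

theorem denseRange_toSL2ZCompletion : DenseRange toSL2ZCompletion :=
  ProfiniteCompletion.denseRange (GrpCat.of SL(2, ℤ))

theorem toSL2ZHat_surjective : Function.Surjective toSL2ZHat := by
  have hcl : IsClosed (Set.range toSL2ZHat) := (isCompact_range toSL2ZHat.continuous_toFun).isClosed
  intro x
  change x ∈ Set.range toSL2ZHat
  refine closure_minimal ?_ hcl (denseRange_SL2Z x)
  rintro _ ⟨γ, rfl⟩
  exact ⟨_, toSL2ZHat_toSL2ZCompletion γ⟩

/-- The preimage of the clopen set `D n` meets SL₂(ℤ) exactly in Γ(n), so by density it is the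
closure of Γ(n). The sets `D n` intersect in the identity. -/
theorem toSL2ZHat_eq_one_iff (x : SL2ZCompletion) : toSL2ZHat x = 1 ↔ x ∈ congruenceKernel := by
  have hcont : ∀ (n : ℕ+), Continuous fun g : SL(2, ZHat) => fun i j => residue n (g.1 i j) :=
    fun n => continuous_pi fun i => continuous_pi fun j => (continuous_residue n).comp
      ((continuous_apply j).comp ((continuous_apply i).comp continuous_subtype_val))
  let D : ℕ+ → Set SL(2, ZHat) := fun n =>
    {g | (fun i j => residue n (g.1 i j)) = fun i j => residue n ((1 : SL(2, ZHat)).1 i j)}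
  have hD : ∀ n, IsClopen (D n) := fun n => (isClopen_discrete {_}).preimage (hcont n)
  have hmem : ∀ (n : ℕ+) (γ : SL(2, ℤ)),
      toSL2ZHat (toSL2ZCompletion γ) ∈ D n ↔ γ ∈ CongruenceSubgroup.Gamma n := by
    intro n γ
    rw [toSL2ZHat_toSL2ZCompletion, CongruenceSubgroup.Gamma_mem']
    have h1 : ∀ i j, residue n ((1 : SL(2, ZHat)).1 i j) = (1 : SL(2, ZMod n)).1 i j := by
      intro i j
      by_cases h : i = j <;> simp [h]
    constructor
    · intro h
      ext i j
      rw [← h1, ← congrFun (congrFun h i) j]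
      simp
    · intro h
      funext i j
      rw [h1, ← h]
      simp
  constructor
  · intro hx
    refine Set.mem_iInter₂.mpr fun n hn => ?_
    lift n to ℕ+ using hn
    rw [mem_closure_iff]
    intro O hO hxO
    have hO' : IsOpen (O ∩ toSL2ZHat ⁻¹' D n) :=
      hO.inter ((hD n).isOpen.preimage toSL2ZHat.continuous_toFun)
    obtain ⟨γ, hγO, hγ⟩ := denseRange_toSL2ZCompletion.exists_mem_open hO'
      ⟨x, hxO, by rw [Set.mem_preimage, hx]; rfl⟩
    exact ⟨_, hγO, γ, (hmem n γ).mp hγ, rfl⟩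
  · intro hx
    refine Matrix.SpecialLinearGroup.ext _ _ fun i j => ZHat_ext fun n => ?_
    have h1 := Set.mem_iInter₂.mp hx n n.pos
    have h2 : x ∈ toSL2ZHat ⁻¹' D n := by
      refine closure_minimal ?_ ((hD n).isClosed.preimage toSL2ZHat.continuous_toFun) h1
      rintro _ ⟨γ, hγ, rfl⟩
      exact (hmem n γ).mpr hγ
    exact congrFun (congrFun h2 i) j

end Density

/-! ### The matrix of an automorphism of the free group -/

section FreeGroupAut

open scoped commutatorElement

theorem abF_apply (φ : MulAut F) (w : F) :
    (abF (φ w)).toAdd = (abMatrix φ).mulVec (abF w).toAdd := by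
  let L : Multiplicative (Fin 2 → ℤ) →* Multiplicative (Fin 2 → ℤ) :=
    AddMonoidHom.toMultiplicative (Matrix.mulVecLin (abMatrix φ)).toAddMonoidHom
  have h : abF.comp φ.toMonoidHom = L.comp abF := by
    ext j : 1
    apply Multiplicative.toAdd.injective
    change (abF (φ (FreeGroup.of j))).toAdd =
      (abMatrix φ).mulVec (abF (FreeGroup.of j)).toAdd
    rw [show (abF (FreeGroup.of j)).toAdd = Pi.single j 1 by simp [abF], Matrix.mulVec_single_one]
    rfl
  exact congrArg Multiplicative.toAdd (DFunLike.congr_fun h w)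

theorem abMatrix_mul (φ ψ : MulAut F) : abMatrix (φ * ψ) = abMatrix φ * abMatrix ψ := by
  ext i j
  exact congrFun (abF_apply φ (ψ (FreeGroup.of j))) i

theorem abMatrix_one : abMatrix 1 = 1 := by
  ext i j
  simp [abMatrix, abF, Matrix.one_apply, Pi.single_apply]

theorem ker_abF : abF.ker = commutator F := by
  refine le_antisymm ?_ (Abelianization.commutator_subset_ker abF)
  let r : Multiplicative (Fin 2 → ℤ) →* Abelianization F :=
    { toFun := fun v => Abelianization.of (FreeGroup.of 0) ^ (v.toAdd 0) *
        Abelianization.of (FreeGroup.of 1) ^ (v.toAdd 1)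
      map_one' := by simp
      map_mul' := fun v w => by
        simp only [toAdd_mul, Pi.add_apply, zpow_add]
        exact mul_mul_mul_comm _ _ _ _ }
  have hr : (Abelianization.of : F →* Abelianization F) = r.comp abF := by
    ext j : 1
    fin_cases j <;> simp [r, abF]
  rw [← Abelianization.ker_of, hr]
  intro w hw
  rw [MonoidHom.mem_ker, MonoidHom.comp_apply, MonoidHom.mem_ker.mp hw, map_one]

/-- The automorphism `x₀ ↦ x₁`, `x₁ ↦ x₀⁻¹` of the free group. -/
def autS : MulAut F :=
  MonoidHom.toMulEquiv (FreeGroup.lift ![FreeGroup.of 1, (FreeGroup.of 0)⁻¹])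
    (FreeGroup.lift ![(FreeGroup.of 1)⁻¹, FreeGroup.of 0])
    (by ext j : 1; fin_cases j <;> simp) (by ext j : 1; fin_cases j <;> simp)

/-- The automorphism `x₀ ↦ x₀`, `x₁ ↦ x₀ * x₁` of the free group. -/
def autT : MulAut F :=
  MonoidHom.toMulEquiv (FreeGroup.lift ![FreeGroup.of 0, FreeGroup.of 0 * FreeGroup.of 1])
    (FreeGroup.lift ![FreeGroup.of 0, (FreeGroup.of 0)⁻¹ * FreeGroup.of 1])
    (by ext j : 1; fin_cases j <;> simp) (by ext j : 1; fin_cases j <;> simp)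

theorem autS_of (j : Fin 2) :
    autS (FreeGroup.of j) = (![FreeGroup.of 1, (FreeGroup.of 0)⁻¹] : Fin 2 → F) j :=
  FreeGroup.lift_apply_of ..

theorem autT_of (j : Fin 2) :
    autT (FreeGroup.of j) = (![FreeGroup.of 0, FreeGroup.of 0 * FreeGroup.of 1] : Fin 2 → F) j :=
  FreeGroup.lift_apply_of ..

/-- The commutator of the generators of the free group. -/
abbrev commF : F := ⁅FreeGroup.of (0 : Fin 2), FreeGroup.of (1 : Fin 2)⁆

/-- Every element of `SL₂(ℤ)` lifts to an automorphism of the free group that maps `[x₀, x₁]` to a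
conjugate. -/
theorem exists_lift_SL2Z (γ : SL(2, ℤ)) :
    ∃ φ : MulAut F, abMatrix φ = γ.val ∧ ∃ w, φ commF = w * commF * w⁻¹ := by
  let H : Subgroup SL(2, ℤ) :=
    { carrier := {γ | ∃ φ : MulAut F, abMatrix φ = γ.val ∧ ∃ w, φ commF = w * commF * w⁻¹}
      one_mem' := ⟨1, abMatrix_one, 1, by simp⟩
      mul_mem' := by
        rintro γ γ' ⟨φ, hφ, w, hw⟩ ⟨φ', hφ', w', hw'⟩
        refine ⟨φ * φ', by rw [abMatrix_mul, hφ, hφ']; rfl, φ w' * w, ?_⟩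
        rw [MulAut.mul_apply, hw', map_mul, map_mul, hw, map_inv]
        group
      inv_mem' := by
        rintro γ ⟨φ, hφ, w, hw⟩
        refine ⟨φ⁻¹, ?_, φ⁻¹ w⁻¹, ?_⟩
        · have h1 : abMatrix φ⁻¹ * γ.val = 1 := by
            rw [← hφ, ← abMatrix_mul, inv_mul_cancel, abMatrix_one]
          have h2 : γ.val * (γ⁻¹).val = 1 := by
            rw [← Matrix.SpecialLinearGroup.coe_mul, mul_inv_cancel]
            rfl
          exact left_inv_eq_right_inv h1 h2
        · apply φ.injective
          simp only [map_mul, map_inv, MulAut.apply_inv_self, hw]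
          group }
  suffices h : H = ⊤ by
    have hγ : γ ∈ H := h ▸ Subgroup.mem_top γ
    exact hγ
  -- It suffices to lift S and T: [x₁, x₀⁻¹] = x₀⁻¹[x₀, x₁]x₀ and [x₀, x₀x₁] = x₀[x₀, x₁]x₀⁻¹.
  rw [← top_le_iff, ← SpecialLinearGroup.SL2Z_generators, Subgroup.closure_le]
  rintro _ (rfl | rfl)
  · refine ⟨autS, ?_, (FreeGroup.of 0)⁻¹, ?_⟩
    · ext i j
      fin_cases i <;> fin_cases j <;> simp [abMatrix, autS_of, abF, ModularGroup.S]
    · rw [map_commutatorElement, autS_of, autS_of, commutatorElement_def, commF,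
        commutatorElement_def]
      simp [mul_assoc]
  · refine ⟨autT, ?_, FreeGroup.of 0, ?_⟩
    · ext i j
      fin_cases i <;> fin_cases j <;> simp [abMatrix, autT_of, abF, ModularGroup.T]
    · rw [map_commutatorElement, autT_of, autT_of, commutatorElement_def, commF,
        commutatorElement_def]
      simp [mul_assoc]

end FreeGroupAut

/-! ### Automorphisms of `F` acting trivially on `ℤ²` -/

section DiscreteIA

open Polynomial
open scoped IsMulCommutative commutatorElement

/-- The element `[x₁, x₂]` of `M` has trivial annihilator. -/
theorem eq_zero_of_polyAct_commElt_M (p : BiPoly)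
    (hp : polyAct (commutator M) (commutatorElement_mem_commutator (genM 0) (genM 1)) p
      (commElt _ (commutatorElement_mem_commutator (genM 0) (genM 1))) = 0) : p = 0 := by
  let ι := algebraMap BiPoly (FractionRing BiPoly)
  have hι : Function.Injective ι := IsFractionRing.injective BiPoly (FractionRing BiPoly)
  have hX : ι X ≠ 0 := (map_ne_zero_iff ι hι).mpr X_ne_zero
  have hCX : ι (C X) ≠ 0 := (map_ne_zero_iff ι hι).mpr (C_ne_zero.mpr X_ne_zero)
  -- Over the fraction field a and b are invertible, so the affine representation exists there and
  -- gives p(a - 1) = 0 in a domain.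
  let μ₀ : F →* Aff (FractionRing BiPoly) :=
    FreeGroup.lift ![⟨Units.mk0 _ hX, 0⟩, ⟨Units.mk0 _ hCX, 1⟩]
  let μ : M →* Aff (FractionRing BiPoly) :=
    QuotientGroup.lift (derivedSeries F 2) μ₀ (derivedSeries_two_le_ker_Aff μ₀)
  have hN : ∀ m ∈ commutator M, (μ m).u = 1 :=
    fun m hm => Abelianization.commutator_subset_ker (Aff.linear.comp μ) hm
  have h := aff_polyAct_commElt (commutator M)
    (commutatorElement_mem_commutator (genM 0) (genM 1)) μ hN (Units.mk0 _ hX) (Units.mk0 _ hCX)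
    (FreeGroup.lift_apply_of ..) (FreeGroup.lift_apply_of ..) p
  rw [hp] at h
  have h1 : (μ ((0 : Additive (commutator M)).toMul : M)).t = 0 := by
    rw [show ((0 : Additive (commutator M)).toMul : M) = 1 from rfl, map_one, Aff.one_t]
  rw [h1] at h
  simp only [Units.val_mk0, biEval_eq_ringHom ι] at h
  have h2 := (map_eq_zero_iff ι hι).mp h.symm
  exact (mul_eq_zero.mp h2).resolve_right (X_sub_C_ne_zero (1 : ℤ[X]))

/-- Replaces Nielsen's theorem that such φ are inner: preserving the conjugacy class of the
commutator is enough, and this can be checked in F/F''. -/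
theorem exists_conj_of_abMatrix_eq_one {φ : MulAut F} (hφ : abMatrix φ = 1) :
    ∃ g : MHat, toMHat (φ commF) = g * toMHat commF * g⁻¹ := by
  have hmem : ∀ i, autM φ (genM i) * (genM i)⁻¹ ∈ commutator M := by
    intro i
    have h1 : φ (FreeGroup.of i) * (FreeGroup.of i)⁻¹ ∈ commutator F := by
      rw [← ker_abF, MonoidHom.mem_ker, map_mul, map_inv, mul_inv_eq_one]
      apply Multiplicative.toAdd.injective
      rw [abF_apply, hφ, Matrix.one_mulVec]
    have h2 : (commutator F).map (QuotientGroup.mk' (derivedSeries F 2)) ≤ commutator M := by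
      rw [commutator_def, Subgroup.map_commutator]
      exact Subgroup.commutator_mono le_top le_top
    exact h2 ⟨_, h1, rfl⟩
  obtain ⟨g, hg⟩ := exists_conj_commutatorElement closure_genM eq_zero_of_polyAct_commElt_M
    (autM φ) (hmem 0) (hmem 1)
  refine ⟨etaM g, ?_⟩
  have h := congrArg etaM hg
  rw [map_mul, map_mul, map_inv] at h
  exact h

end DiscreteIA

/-! ### The outer action -/

section Outer

open scoped commutatorElement

/-- The matrix by which an automorphism of `MHat` acts on `ZHat²`. -/
noncomputable def matHat (f : contAut MHat) : Matrix (Fin 2) (Fin 2) ZHat :=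
  Matrix.of fun i j => (coordMHat (f.1 (gen j))).toAdd i

theorem coordMHat_gen (j : Fin 2) : (coordMHat (gen j)).toAdd = Pi.single j 1 := by
  rw [gen, coordMHat_toMHat, abFHat, FreeGroup.lift_apply_of, toAdd_ofAdd]

theorem coordMHat_apply (f : contAut MHat) (g : MHat) :
    (coordMHat (f.1 g)).toAdd = (matHat f).mulVec (coordMHat g).toAdd := by
  let L : Multiplicative (Fin 2 → ZHat) →* Multiplicative (Fin 2 → ZHat) :=
    AddMonoidHom.toMultiplicative (Matrix.mulVecLin (matHat f)).toAddMonoidHom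
  have hL : Continuous L := continuous_ofAdd.comp
    (Continuous.matrix_mulVec continuous_const continuous_toAdd : _)
  have h := hom_ext_MHat (f := coordMHat.toMonoidHom.comp f.1.toMonoidHom)
    (g := L.comp coordMHat.toMonoidHom) (coordMHat.continuous_toFun.comp f.2.1)
    (hL.comp coordMHat.continuous_toFun) fun j => by
      apply Multiplicative.toAdd.injective
      change (coordMHat (f.1 (gen j))).toAdd = (matHat f).mulVec (coordMHat (gen j)).toAdd
      rw [coordMHat_gen, Matrix.mulVec_single_one]
      rfl
  exact congrArg Multiplicative.toAdd (DFunLike.congr_fun h g)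

theorem continuous_matHat : Continuous matHat :=
  continuous_pi fun i => continuous_pi fun j => (continuous_apply i).comp
    (continuous_toAdd.comp (coordMHat.continuous_toFun.comp (continuous_eval_contAut (gen j))))

/-- `matHat` as a homomorphism of monoids. -/
noncomputable def matHatHom : contAut MHat →* Matrix (Fin 2) (Fin 2) ZHat where
  toFun := matHat
  map_one' := by
    refine Matrix.ext fun i j => ?_
    change (coordMHat (gen j)).toAdd i = _
    rw [coordMHat_gen, Matrix.one_apply, Pi.single_apply]
  map_mul' f f' := by
    refine Matrix.ext fun i j => ?_
    exact congrFun (coordMHat_apply f (f'.1 (gen j))) i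

theorem matHat_mul (f f' : contAut MHat) : matHat (f * f') = matHat f * matHat f' :=
  map_mul matHatHom f f'

theorem matHat_conjMHat (g : MHat) : matHat (conjMHat g) = 1 := by
  rw [← map_one matHatHom]
  refine Matrix.ext fun i j => ?_
  change (coordMHat (g * gen j * g⁻¹)).toAdd i = (coordMHat (gen j)).toAdd i
  rw [map_mul coordMHat, map_mul coordMHat, map_inv coordMHat, mul_comm (coordMHat g),
    mul_inv_cancel_right]

theorem matHat_autMHat (φ : MulAut F) :
    matHat (autMHat φ) = (abMatrix φ).map (Int.castRingHom ZHat) := by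
  refine Matrix.ext fun i j => ?_
  change (coordMHat ((autMHat φ).1 (toMHat _))).toAdd i = _
  rw [autMHat_toMHat, coordMHat_toMHat, abFHat_apply]
  rfl

/-- The automorphisms of `MHat` that act on `ZHat²` with determinant one and map `[x₁, x₂]` to a
conjugate. -/
noncomputable def gammaHat : Subgroup (contAut MHat) where
  carrier := {f | (matHat f).det = 1 ∧ ∃ g : MHat, f.1 (toMHat commF) = g * toMHat commF * g⁻¹}
  one_mem' := ⟨by rw [show matHat 1 = 1 from map_one matHatHom, Matrix.det_one], 1, by simp⟩
  mul_mem' := by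
    rintro f f' ⟨hf, g, hg⟩ ⟨hf', g', hg'⟩
    refine ⟨by rw [matHat_mul, Matrix.det_mul, hf, hf', one_mul], f.1 g' * g, ?_⟩
    change f.1 (f'.1 (toMHat commF)) = _
    rw [hg', map_mul, map_mul, hg, map_inv]
    group
  inv_mem' := by
    rintro f ⟨hf, g, hg⟩
    refine ⟨?_, f.1.symm g⁻¹, ?_⟩
    · have h := congrArg Matrix.det (matHat_mul f⁻¹ f)
      rw [inv_mul_cancel, show matHat 1 = 1 from map_one matHatHom, Matrix.det_one, Matrix.det_mul,
        hf, mul_one] at h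
      exact h.symm
    · apply f.1.injective
      change f.1 (f.1.symm _) = _
      simp only [map_mul, map_inv, MulEquiv.apply_symm_apply, hg]
      group

theorem isClosed_gammaHat : IsClosed (gammaHat : Set (contAut MHat)) := by
  refine IsClosed.inter (isClosed_eq (continuous_matHat.matrix_det) continuous_const) ?_
  have hcl : IsClosed (Set.range fun g : MHat => g * toMHat commF * g⁻¹) :=
    (isCompact_range (by fun_prop)).isClosed
  have h := hcl.preimage (continuous_eval_contAut (toMHat commF))
  have hset : {f : contAut MHat | ∃ g : MHat, f.1 (toMHat commF) = g * toMHat commF * g⁻¹} =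
      (fun f : contAut MHat => f.1 (toMHat commF)) ⁻¹'
        Set.range fun g : MHat => g * toMHat commF * g⁻¹ :=
    Set.ext fun f => exists_congr fun g => eq_comm
  rw [← hset] at h
  exact h

/-- Composing with an inner automorphism makes f fix the commutator exactly and leaves its matrix
unchanged. -/
theorem mem_innAut_of_matHat_eq_one {f : contAut MHat} (hf : f ∈ gammaHat) (h1 : matHat f = 1) :
    f ∈ innAut MHat := by
  obtain ⟨-, g, hg⟩ := hf
  have h2 : (conjMHat g)⁻¹ * f ∈ innAut MHat := by
    refine mem_innAut_of_fixes_commutator _ (fun i => ?_) ?_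
    · rw [mem_NHat, map_mul, map_inv, mul_inv_eq_one]
      apply Multiplicative.toAdd.injective
      rw [coordMHat_apply, matHat_mul, h1, ← map_inv, matHat_conjMHat, mul_one, Matrix.one_mulVec]
    · change (conjMHat g)⁻¹.1 (f.1 ⁅toMHat _, toMHat _⁆) = ⁅toMHat _, toMHat _⁆
      rw [← map_commutatorElement toMHat, hg, ← map_inv, conjMHat_apply]
      group
  have h3 := mul_mem (mem_innAut_iff.mpr ⟨g, rfl⟩) h2
  rwa [mul_inv_cancel_left] at h3

/-- An arbitrary lift φ of γ differs from the lift ψ built from S and T by an automorphism trivial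
on ℤ², and both factors preserve the conjugacy class of the commutator. -/
theorem autMHat_mem_gammaHat {φ : MulAut F} {γ : SL(2, ℤ)} (h : abMatrix φ = γ.val) :
    autMHat φ ∈ gammaHat := by
  have hdet : ∀ ψ : MulAut F, abMatrix ψ = γ.val → (matHat (autMHat ψ)).det = 1 := by
    intro ψ hψ
    rw [matHat_autMHat, hψ]
    exact (Matrix.SpecialLinearGroup.map (Int.castRingHom ZHat) γ).det_coe
  obtain ⟨ψ, hψ, w, hw⟩ := exists_lift_SL2Z γ
  have hψmem : autMHat ψ ∈ gammaHat := by
    refine ⟨hdet ψ hψ, toMHat w, ?_⟩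
    rw [autMHat_toMHat, hw, map_mul, map_mul, map_inv]
  have h1 : abMatrix (φ * ψ⁻¹) = 1 := by
    have h2 : abMatrix ψ * abMatrix ψ⁻¹ = 1 := by
      rw [← abMatrix_mul, mul_inv_cancel, abMatrix_one]
    rw [abMatrix_mul, h, ← hψ, h2]
  have h3 : autMHat (φ * ψ⁻¹) ∈ gammaHat := by
    refine ⟨by rw [matHat_autMHat, h1, Matrix.map_one _ (map_zero _) (map_one _),
      Matrix.det_one], ?_⟩
    rw [autMHat_toMHat]
    exact exists_conj_of_abMatrix_eq_one h1
  have h4 := mul_mem h3 hψmem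
  rwa [← map_mul, inv_mul_cancel_right] at h4

/-- The matrix by which an outer automorphism of `MHat` acts on `ZHat²`. -/
noncomputable def matOut : ContOut MHat →* Matrix (Fin 2) (Fin 2) ZHat :=
  QuotientGroup.lift (innAut MHat) matHatHom fun f hf => by
    obtain ⟨g, rfl⟩ := mem_innAut_iff.mp hf
    exact matHat_conjMHat g

theorem continuous_matOut : Continuous matOut := continuous_matHat.quotient_lift _

/-- The image of `gammaHat` in the group of outer automorphisms. -/
noncomputable def gammaOut : Subgroup (ContOut MHat) :=
  gammaHat.map (QuotientGroup.mk' (innAut MHat))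

instance : CompactSpace gammaOut :=
  isCompact_iff_compactSpace.mp (isClosed_gammaHat.isCompact.image QuotientGroup.continuous_mk)

/-- The homomorphism to `SL₂(ZHat)` induced by `matOut`. -/
noncomputable def gammaOutToSL : gammaOut →* SL(2, ZHat) where
  toFun x := ⟨matOut x.1, by
    obtain ⟨_, f, hf, rfl⟩ := x
    exact hf.1⟩
  map_one' := Subtype.ext (map_one matOut)
  map_mul' x y := Subtype.ext (map_mul matOut x.1 y.1)

theorem continuous_gammaOutToSL : Continuous gammaOutToSL :=
  (continuous_matOut.comp continuous_subtype_val).subtype_mk _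

theorem mk_autMHat_mem_gammaOut {φ : MulAut F} {γ : SL(2, ℤ)} (h : abMatrix φ = γ.val) :
    (QuotientGroup.mk (autMHat φ) : ContOut MHat) ∈ gammaOut :=
  ⟨_, autMHat_mem_gammaHat h, rfl⟩

theorem gammaOutToSL_mk_autMHat {φ : MulAut F} {γ : SL(2, ℤ)} (h : abMatrix φ = γ.val) :
    gammaOutToSL ⟨_, mk_autMHat_mem_gammaOut h⟩ =
      Matrix.SpecialLinearGroup.map (Int.castRingHom ZHat) γ := by
  apply Subtype.ext
  change matHat (autMHat φ) = _
  rw [matHat_autMHat, h]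
  rfl

theorem gammaOutToSL_bijective : Function.Bijective gammaOutToSL := by
  constructor
  · rw [injective_iff_map_eq_one]
    rintro ⟨_, f, hf, rfl⟩ h
    apply Subtype.ext
    exact (QuotientGroup.eq_one_iff f).mpr
      (mem_innAut_of_matHat_eq_one hf (congrArg Subtype.val h))
  · have hcl : IsClosed (Set.range gammaOutToSL) :=
      (isCompact_range continuous_gammaOutToSL).isClosed
    intro x
    change x ∈ Set.range gammaOutToSL
    refine closure_minimal ?_ hcl (denseRange_SL2Z x)
    rintro _ ⟨γ, rfl⟩
    obtain ⟨φ, hφ, -⟩ := exists_lift_SL2Z γ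
    exact ⟨_, gammaOutToSL_mk_autMHat hφ⟩

/-- The isomorphism from `SL₂(ZHat)` to `gammaOut`. -/
noncomputable def slEquivGammaOut : SL(2, ZHat) ≃ₜ* gammaOut :=
  let e := MulEquiv.ofBijective gammaOutToSL gammaOutToSL_bijective
  { e.symm with
    continuous_toFun :=
      (Continuous.homeoOfEquivCompactToT2 (f := e.toEquiv) continuous_gammaOutToSL).symm.continuous
    continuous_invFun := continuous_gammaOutToSL }

theorem gammaOutToSL_slEquivGammaOut (g : SL(2, ZHat)) : gammaOutToSL (slEquivGammaOut g) = g :=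
  (MulEquiv.ofBijective gammaOutToSL gammaOutToSL_bijective).apply_symm_apply g

/-! ### Comparison with the abelianization and assembly of ρ -/

theorem coordAHat_slAct (g : SL(2, ZHat)) (a : AHat) :
    (coordAHat ((slAct g).1 a)).toAdd = g.1.mulVec (coordAHat a).toAdd := by
  change (coordAHat (coordAHat.symm _)).toAdd = _
  rw [MulEquiv.apply_symm_apply]
  rfl

theorem slAct_injective : Function.Injective slAct := by
  intro g h hgh
  apply Subtype.ext
  refine Matrix.ext fun i j => ?_
  have h1 := coordAHat_slAct g (QuotientGroup.mk (gen j))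
  rw [hgh, coordAHat_slAct, coordAHat_mk, coordMHat_gen, Matrix.mulVec_single_one,
    Matrix.mulVec_single_one] at h1
  exact (congrFun h1 i).symm

theorem abOut_eq_slAct (x : gammaOut) : abOut MHat x = slAct (gammaOutToSL x) := by
  obtain ⟨_, f, hf, rfl⟩ := x
  apply Subtype.ext
  ext a
  induction a using QuotientGroup.induction_on with
  | H m =>
    apply coordAHat.injective
    apply Multiplicative.toAdd.injective
    rw [coordAHat_slAct, coordAHat_mk]
    exact coordMHat_apply f m

theorem abOut_slEquivGammaOut (g : SL(2, ZHat)) : abOut MHat (slEquivGammaOut g) = slAct g := by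
  rw [abOut_eq_slAct, gammaOutToSL_slEquivGammaOut]

/-- The outer representation of the profinite completion of `SL₂(ℤ)` on `MHat`. -/
noncomputable def outerRep : SL2ZCompletion →* ContOut MHat :=
  gammaOut.subtype.comp (slEquivGammaOut.toMonoidHom.comp toSL2ZHat.toMonoidHom)

theorem outerRep_apply (x : SL2ZCompletion) :
    outerRep x = (slEquivGammaOut (toSL2ZHat x) : ContOut MHat) := rfl

theorem range_outerRep : outerRep.range = gammaOut := by
  ext y
  constructor
  · rintro ⟨x, rfl⟩
    exact SetLike.coe_mem _
  · intro hy
    obtain ⟨x, hx⟩ := toSL2ZHat_surjective (slEquivGammaOut.symm ⟨y, hy⟩)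
    refine ⟨x, ?_⟩
    rw [outerRep_apply, hx, ContinuousMulEquiv.apply_symm_apply]

theorem isOuterRepresentation_outerRep : IsOuterRepresentation outerRep := by
  refine ⟨continuous_subtype_val.comp
    (slEquivGammaOut.continuous_toFun.comp toSL2ZHat.continuous_toFun), fun φ γ h => ?_⟩
  rw [outerRep_apply, toSL2ZHat_toSL2ZCompletion, ← gammaOutToSL_mk_autMHat h]
  exact congrArg Subtype.val
    ((MulEquiv.ofBijective gammaOutToSL gammaOutToSL_bijective).symm_apply_apply
      ⟨_, mk_autMHat_mem_gammaOut h⟩)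

theorem IsOuterRepresentation.unique {ρ ρ' : SL2ZCompletion →* ContOut MHat}
    (h : IsOuterRepresentation ρ) (h' : IsOuterRepresentation ρ') : ρ = ρ' := by
  refine DFunLike.coe_injective (denseRange_toSL2ZCompletion.equalizer h.1 h'.1 ?_)
  funext γ
  obtain ⟨φ, hφ, -⟩ := exists_lift_SL2Z γ
  exact (h.2 φ γ hφ).trans (h'.2 φ γ hφ).symm

theorem bijOn_abOut :
    Set.BijOn (abOut MHat) (gammaOut : Set (ContOut MHat)) (SLAHat : Set (contAut AHat)) := by
  refine ⟨fun x hx => ⟨_, (abOut_eq_slAct ⟨x, hx⟩).symm⟩, fun x hx y hy hxy => ?_, ?_⟩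
  · have h : slAct (gammaOutToSL ⟨x, hx⟩) = slAct (gammaOutToSL ⟨y, hy⟩) := by
      rw [← abOut_eq_slAct, ← abOut_eq_slAct]
      exact hxy
    exact congrArg Subtype.val (gammaOutToSL_bijective.1 (slAct_injective h))
  · rintro _ ⟨g, rfl⟩
    exact ⟨_, SetLike.coe_mem _, abOut_slEquivGammaOut g⟩

theorem outerRep_eq_one_iff (x : SL2ZCompletion) : outerRep x = 1 ↔ x ∈ congruenceKernel := by
  rw [← toSL2ZHat_eq_one_iff, outerRep_apply, OneMemClass.coe_eq_one]
  exact EmbeddingLike.map_eq_one_iff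

theorem exists_equiv_range_outerRep :
    ∃ e : SL(2, ZHat) ≃ₜ* outerRep.range,
      (∀ g : SL(2, ZHat), abOut MHat (e g : ContOut MHat) = slAct g) ∧
      ∀ x : SL2ZCompletion, (e (toSL2ZHat x) : ContOut MHat) = outerRep x := by
  rw [range_outerRep]
  exact ⟨slEquivGammaOut, abOut_slEquivGammaOut, fun _ => rfl⟩

end Outer

end ProMetabelian

/-- The outer representation of the profinite completion of `SL₂(ℤ)` on the free profinite
metabelian group `MHat` of rank 2 exists and is unique; `ab_*` carries its image isomorphically onto
`SL(MHat^ab) ≅ SL₂(ZHat)`; it factors through `SL₂(ZHat)`, and its kernel is the congruence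
kernel. -/
theorem mainTheorem1 :
    ∃ ρ : SL2ZCompletion →* ContOut MHat,
      IsOuterRepresentation ρ ∧
      (∀ ρ' : SL2ZCompletion →* ContOut MHat, IsOuterRepresentation ρ' → ρ' = ρ) ∧
      Set.BijOn (abOut MHat) (ρ.range : Set (ContOut MHat)) (SLAHat : Set (contAut AHat)) ∧
      (∃ e : SL(2, ZHat) ≃ₜ* ρ.range,
        (∀ g : SL(2, ZHat), abOut MHat (e g : ContOut MHat) = slAct g) ∧
        ∀ x : SL2ZCompletion, (e (toSL2ZHat x) : ContOut MHat) = ρ x) ∧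
      (∀ x : SL2ZCompletion, ρ x = 1 ↔ x ∈ congruenceKernel) :=
  ⟨outerRep, isOuterRepresentation_outerRep, fun _ h => h.unique isOuterRepresentation_outerRep,
    range_outerRep ▸ bijOn_abOut, exists_equiv_range_outerRep, outerRep_eq_one_iff⟩
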